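/- All matroids are on finite ground sets. Let $M$ be a matroid of rank $r$ with ground set $E$ and set of bases $\mathcal B$. A hyperplane $H$ of $M$ (a flat of rank $r-1$) is called *stressed* if every $r$-element subset of $H$ is a circuit of $M$. In that case $\mathcal B\cup\{S\subseteq H: |S|=r\}$ is the set of bases of a matroid on $E$, called the *relaxation* of $M$ at $H$. For a matroid $N$ and $n\ge 0$, a *tuple of degree $n$* is an ordered tuple $(B_1,\dots,B_n)$ of bases of $N$. A *symmetric exchange* in $N$ changes a tuple of bases $(B_1,\dots,B_n)$ by choosing positions $i\neq j$ and elements $a\in B_i\setminus B_j$, $b\in B_j\setminus B_i$ such that $(B_i\setminus\{a\})\cup\{b\}$ and $(B_j\setminus\{b\})\cup\{a\}$ are both bases of $N$, and replacing $B_i$ and $B_j$ by these two bases, respectively, while keeping all other entries. An *exchange sequence* in $N$ with $\ell\ge 0$ steps is a sequence of $\ell+1$ tuples of bases of $N$ in which each tuple after the first arises from the preceding one by a symmetric exchange in $N$; it connects its first tuple to its last one. *White's conjecture holds for $N$* means: for every $n$, any two tuples $(B_1,\dots,B_n)$ and $(B_1',\dots,B_n')$ of bases of $N$ with equal multiset union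 (every element $e$ lies in as many of the $B_i$ as of the $B_i'$) are connected by an exchange sequence in $N$. **Theorem.** Let $M$ be a matroid with a stressed hyperplane $H$, and let $\widetilde M$ be the relaxation of $M$ at $H$. Then the following are true. 1. If White's conjecture holds for $M$, then White's conjecture holds for $\widetilde M$. 2. Suppose that White's conjecture holds for $\widetilde M$ and that $M$ satisfies the condition (*) any two tuples of bases of $M$ of degree $2$ or $3$ that are connected by an exchange sequence with two steps in $\widetilde M$ can be connected by an exchange sequence in $M$. Then White's conjecture holds for $M$. -/

import Mathlib

open Set

namespace WhiteExchange

variable {α : Type*}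

/-- A hyperplane of `M`: a flat of rank `r - 1`, where `r` is the rank of `M`. -/
def IsHyperplane (M : Matroid α) (H : Set α) : Prop :=
  M.IsFlat H ∧ M.eRk H + 1 = M.eRank

/-- A stressed hyperplane of `M`: a hyperplane `H` such that every subset of `H` of size `r`
is a circuit, where `r` is the rank of `M`. -/
def IsStressedHyperplane (M : Matroid α) (H : Set α) : Prop :=
  IsHyperplane M H ∧ ∀ S ⊆ H, S.encard = M.eRank → M.IsCircuit S

/-- The bases of the relaxation of `M` at `H`: the bases of `M`, together with the subsets of `H`
whose size is the rank of `M`. -/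
def IsRelaxedBase (M : Matroid α) (H : Set α) (B : Set α) : Prop :=
  M.IsBase B ∨ (B ⊆ H ∧ B.encard = M.eRank)

theorem IsRelaxedBase.encard_eq {M : Matroid α} {H B : Set α} (hB : IsRelaxedBase M H B) :
    B.encard = M.eRank := by
  rcases hB with h | h
  · exact h.encard_eq_eRank
  · exact h.2

theorem isBase_insert_of_notMem {M : Matroid α} [M.Finite] {I : Set α} {f : α}
    (hI : M.Indep I) (hcard : I.encard + 1 = M.eRank) (hf : f ∈ M.E) (hfI : f ∉ M.closure I) :
    M.IsBase (insert f I) := by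
  have hfI' : f ∉ I := fun h => hfI (M.mem_closure_of_mem h hI.subset_ground)
  have hind : M.Indep (insert f I) := (hI.notMem_closure_iff_of_notMem hfI' hf).1 hfI
  refine hind.isBase_of_eRk_ge (M.set_finite _ hind.subset_ground) ?_
  rw [hind.eRk_eq_encard, encard_insert_of_notMem hfI', hcard]

theorem relaxedBase_exchange {M : Matroid α} [M.Finite] {H : Set α}
    (hH : IsStressedHyperplane M H) : Matroid.ExchangeProperty (IsRelaxedBase M H) := by
  obtain ⟨⟨hflat, hrk⟩, hcirc⟩ := hH
  have hHE : H ⊆ M.E := hflat.subset_ground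
  have hsub : ∀ B, IsRelaxedBase M H B → B ⊆ M.E := fun B hB =>
    hB.elim (fun h => h.subset_ground) (fun h => h.1.trans hHE)
  intro X Y hX hY e he
  have hXfin := M.set_finite X (hsub X hX)
  have hYfin := M.set_finite Y (hsub Y hY)
  have hXY : X.encard = Y.encard := hX.encard_eq.trans hY.encard_eq.symm
  have hcard : (X \ {e}).encard + 1 = M.eRank := by
    rw [encard_sdiff_singleton_add_one he.1, hX.encard_eq]
  obtain ⟨f₀, hf₀⟩ : (Y \ X).Nonempty := by
    rw [Set.sdiff_nonempty]
    intro hYX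
    have := hYfin.eq_of_subset_of_encard_le hYX hXY.le
    exact he.2 (this ▸ he.1)
  -- exchanges inside `H`
  have hin : X \ {e} ⊆ H → Y ⊆ H → ∃ y ∈ Y \ X, IsRelaxedBase M H (insert y (X \ {e})) := by
    intro h1 h2
    refine ⟨f₀, hf₀, Or.inr ⟨insert_subset (h2 hf₀.1) h1, ?_⟩⟩
    rw [encard_insert_of_notMem (fun h => hf₀.2 h.1), hcard]
  rcases hX with hXb | ⟨hXH, hXc⟩
  · rcases hY with hYb | ⟨hYH, hYc⟩
    · obtain ⟨y, hy, h⟩ := hXb.exchange hYb he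
      exact ⟨y, hy, Or.inl h⟩
    · by_cases hXeH : X \ {e} ⊆ H
      · exact hin hXeH hYH
      · have hXe : M.Indep (X \ {e}) := hXb.indep.subset sdiff_subset
        by_cases hcl : Y ⊆ M.closure (X \ {e})
        · exfalso
          have hYcirc := hcirc Y hYH hYc
          have hYrk : M.eRk Y = M.eRk H := by
            have h1 := hYcirc.eRk_add_one_eq
            rw [hYc, ← hrk] at h1
            exact (ENat.add_left_injective_of_ne_top ENat.one_ne_top) h1
          have h1 : M.closure Y = M.closure H :=
            (M.isRkFinite_set Y).closure_eq_closure_of_subset_of_eRk_ge_eRk hYH hYrk.ge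
          have h2 : M.closure Y = M.closure (M.closure (X \ {e})) := by
            refine (M.isRkFinite_set Y).closure_eq_closure_of_subset_of_eRk_ge_eRk hcl ?_
            rw [M.eRk_closure_eq, hXe.eRk_eq_encard, hYrk]
            rw [← hrk] at hcard
            exact ((ENat.add_left_injective_of_ne_top ENat.one_ne_top) hcard).le
          rw [M.closure_closure, h1, hflat.closure] at h2
          exact hXeH (h2 ▸ M.subset_closure _ hXe.subset_ground)
        · obtain ⟨f, hfY, hf⟩ := not_subset.1 hcl
          refine ⟨f, ⟨hfY, fun hfX => hf ?_⟩,
            Or.inl (isBase_insert_of_notMem hXe hcard (hHE (hYH hfY)) hf)⟩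
          refine M.mem_closure_of_mem ⟨hfX, ?_⟩ hXe.subset_ground
          rintro rfl
          exact he.2 hfY
  · rcases hY with hYb | ⟨hYH, hYc⟩
    · have hXe : M.Indep (X \ {e}) := (hcirc X hXH hXc).sdiff_singleton_indep he.1
      have hYH : ¬ Y ⊆ H := by
        intro h
        have h1 := M.eRk_mono h
        rw [hYb.eRk_eq_eRank, ← hrk] at h1
        have h2 : M.eRk H ≠ ⊤ := (M.isRkFinite_set H).eRk_lt_top.ne
        exact absurd h1 (not_le.2 (ENat.lt_add_one_iff h2 |>.2 le_rfl))
      obtain ⟨f, hfY, hf⟩ := not_subset.1 hYH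
      refine ⟨f, ⟨hfY, fun hfX => hf (hXH hfX)⟩,
        Or.inl (isBase_insert_of_notMem hXe hcard (hYb.subset_ground hfY) fun hfc => hf ?_)⟩
      have := M.closure_subset_closure (sdiff_subset.trans hXH : X \ {e} ⊆ H) hfc
      rwa [hflat.closure] at this
    · exact hin (sdiff_subset.trans hXH) hYH

/-- The relaxation of `M` at a stressed hyperplane `H`: the matroid on the ground set of `M` whose
bases are those of `M` together with the subsets of `H` whose size is the rank of `M`. -/
def relaxation (M : Matroid α) [M.Finite] (H : Set α) (hH : IsStressedHyperplane M H) :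
    Matroid α :=
  Matroid.ofIsBaseOfFinite (E := M.E) M.ground_finite (IsRelaxedBase M H)
    (M.exists_isBase.imp fun _ h => Or.inl h)
    (relaxedBase_exchange hH)
    (fun _ h => h.elim (fun h => h.subset_ground) (fun h => h.1.trans hH.1.1.subset_ground))

theorem relaxation_isBase_iff (M : Matroid α) [M.Finite] (H : Set α)
    (hH : IsStressedHyperplane M H) (B : Set α) :
    (relaxation M H hH).IsBase B ↔ M.IsBase B ∨ (B ⊆ H ∧ B.encard = M.eRank) :=
  Iff.rfl

/-- `B` is an (ordered) tuple of bases of `M`, of degree `n`. -/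
def IsBaseTuple (M : Matroid α) {n : ℕ} (B : Fin n → Set α) : Prop :=
  ∀ i, M.IsBase (B i)

/-- The multiset union of a tuple of sets, as a multiplicity function: the multiplicity of `e` is
the number of positions `i` with `e ∈ B i`. -/
noncomputable def multiUnion {n : ℕ} (B : Fin n → Set α) : α → ℕ :=
  fun e => {i | e ∈ B i}.ncard

/-- `C` arises from the tuple `B` by one symmetric exchange in `M`: at two distinct positions
`i`, `j`, elements `a ∈ B i \ B j` and `b ∈ B j \ B i` are swapped, both resulting sets are bases
of `M`, and the other entries stay the same. -/
def ExchangeStep (M : Matroid α) {n : ℕ} (B C : Fin n → Set α) : Prop :=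
  ∃ i j : Fin n, i ≠ j ∧ ∃ a ∈ B i \ B j, ∃ b ∈ B j \ B i,
    C i = insert b (B i \ {a}) ∧ M.IsBase (C i) ∧
    C j = insert a (B j \ {b}) ∧ M.IsBase (C j) ∧
    ∀ k, k ≠ i → k ≠ j → C k = B k

/-- There is an exchange sequence in `M` with exactly `l` steps from `B` to `C`: tuples
`T 0 = B, T 1, …, T l = C` of bases of `M`, each arising from the previous one by a symmetric
exchange. -/
def ExchangeConnectedIn (M : Matroid α) {n : ℕ} (l : ℕ) (B C : Fin n → Set α) : Prop :=
  ∃ T : ℕ → Fin n → Set α, T 0 = B ∧ T l = C ∧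
    (∀ t ≤ l, IsBaseTuple M (T t)) ∧ ∀ t < l, ExchangeStep M (T t) (T (t + 1))

/-- There is an exchange sequence in `M` from `B` to `C`. -/
def ExchangeConnected (M : Matroid α) {n : ℕ} (B C : Fin n → Set α) : Prop :=
  ∃ l : ℕ, ExchangeConnectedIn M l B C

/-- The assertion of White's conjecture for the matroid `M`, in all degrees `n`. -/
def WhiteHolds (M : Matroid α) : Prop :=
  ∀ (n : ℕ) (B C : Fin n → Set α), IsBaseTuple M B → IsBaseTuple M C →
    multiUnion B = multiUnion C → ExchangeConnected M B C

/-- Condition (*): any two tuples of bases of `M` of degree 2 or 3 that are connected by an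
exchange sequence with two steps in `N` are connected by an exchange sequence in `M`. -/
def TwoStepCondition (M N : Matroid α) : Prop :=
  ∀ n : ℕ, n = 2 ∨ n = 3 → ∀ B C : Fin n → Set α, IsBaseTuple M B → IsBaseTuple M C →
    ExchangeConnectedIn N 2 B C → ExchangeConnected M B C

end WhiteExchange

namespace WhiteExchange

variable {α : Type*} {M : Matroid α} {H : Set α} {P Q : Set α → Prop} {m n : ℕ}

/-! ### Stressed hyperplanes -/

theorem IsRelaxedBase.subset_ground (hH : IsStressedHyperplane M H) {B : Set α}
    (hB : IsRelaxedBase M H B) : B ⊆ M.E :=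
  hB.elim (fun h => h.subset_ground) (fun h => h.1.trans hH.1.1.subset_ground)

theorem IsRelaxedBase.isBase {B : Set α} (hB : IsRelaxedBase M H B) (h : ¬ B ⊆ H) :
    M.IsBase B :=
  hB.resolve_right fun h' => h h'.1

theorem IsStressedHyperplane.not_isBase_subset [M.Finite] (hH : IsStressedHyperplane M H)
    {B : Set α} (hB : M.IsBase B) : ¬ B ⊆ H := by
  intro h
  have h1 := M.eRk_mono h
  rw [hB.eRk_eq_eRank, ← hH.1.2] at h1
  have h2 : M.eRk H ≠ ⊤ := (M.isRkFinite_set H).eRk_lt_top.ne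
  exact absurd h1 (not_le.2 (ENat.lt_add_one_iff h2 |>.2 le_rfl))

/-- If `H` has at least `r` elements, `I` is a proper subset of an `r`-subset of `H`, which is a
circuit. Otherwise `H` has no more elements than its rank `r - 1` and is itself independent. -/
theorem IsStressedHyperplane.indep_of_subset [M.Finite] (hH : IsStressedHyperplane M H)
    {I : Set α} (hI : I ⊆ H) (hcard : I.encard + 1 ≤ M.eRank) : M.Indep I := by
  rcases le_or_gt M.eRank H.encard with h | h
  · obtain ⟨S, hIS, hSH, hS⟩ := exists_superset_subset_encard_eq hI (le_self_add.trans hcard) h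
    refine (hH.2 S hSH hS).ssubset_indep (hIS.ssubset_of_ne ?_)
    rintro rfl
    rw [← hS] at hcard
    have hfin : I.encard ≠ ⊤ :=
      (M.set_finite I (hI.trans hH.1.1.subset_ground)).encard_lt_top.ne
    exact absurd hcard (not_le.2 (ENat.lt_add_one_iff hfin |>.2 le_rfl))
  · refine Matroid.Indep.subset ?_ hI
    have hfin : H.Finite := M.set_finite H hH.1.1.subset_ground
    rw [Matroid.indep_iff_eRk_eq_encard_of_finite hfin]
    refine le_antisymm (M.eRk_le_encard H) ?_
    rw [← hH.1.2] at h
    exact Order.le_of_lt_add_one h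

/-- `I` is independent and its closure stays in the flat `H`, so it does not contain `x`. -/
theorem IsStressedHyperplane.isBase_insert [M.Finite] (hH : IsStressedHyperplane M H)
    {I : Set α} {x : α} (hI : I ⊆ H) (hcard : I.encard + 1 = M.eRank) (hx : x ∈ M.E)
    (hxH : x ∉ H) : M.IsBase (insert x I) := by
  refine isBase_insert_of_notMem (hH.indep_of_subset hI hcard.le) hcard hx fun h => hxH ?_
  have := M.closure_subset_closure hI h
  rwa [hH.1.1.closure] at this

/-- A set of the size of a base that has exactly one element outside `H` is a base. -/
theorem IsStressedHyperplane.isBase_of_subset_insert [M.Finite] (hH : IsStressedHyperplane M H)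
    {X : Set α} {x : α} (hX : X ⊆ insert x H) (hxX : x ∈ X) (hcard : X.encard = M.eRank)
    (hx : x ∈ M.E) (hxH : x ∉ H) : M.IsBase X := by
  have h : insert x (X \ {x}) = X := by simp [hxX]
  rw [← h]
  refine hH.isBase_insert ?_ ?_ hx hxH
  · rintro y ⟨hy, hyx⟩
    exact (hX hy).resolve_left hyx
  · rw [encard_sdiff_singleton_add_one hxX, hcard]

theorem encard_swap {X : Set α} {a b : α} (ha : a ∈ X) (hb : b ∉ X) :
    (insert b (X \ {a})).encard = X.encard :=
  encard_exchange hb ha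

/-- A set of the size of a base contained in a stressed hyperplane is not covered, even after
removing one element, by the closure of a set of smaller size that leaves the hyperplane. -/
theorem IsStressedHyperplane.exists_notMem_closure [M.Finite] (hH : IsStressedHyperplane M H)
    {A K : Set α} (hA : A ⊆ H) (hAc : A.encard = M.eRank) (hK : ¬ K ⊆ H) (hKE : K ⊆ M.E)
    (hKc : K.encard + 1 = M.eRank) (a₀ : α) : ∃ a ∈ A, a ≠ a₀ ∧ a ∉ M.closure K := by
  by_contra! hcon
  obtain ⟨I, hIA, hIc, ha₀⟩ : ∃ I ⊆ A, I.encard + 1 = M.eRank ∧ a₀ ∉ I := by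
    by_cases h : a₀ ∈ A
    · exact ⟨A \ {a₀}, sdiff_subset, by rw [encard_sdiff_singleton_add_one h, hAc], by simp⟩
    · have hne : A.Nonempty := by
        rw [← encard_pos, hAc, ← hKc]
        exact pos_of_ne_zero (by simp)
      obtain ⟨a₁, ha₁⟩ := hne
      exact ⟨A \ {a₁}, sdiff_subset, by rw [encard_sdiff_singleton_add_one ha₁, hAc],
        fun h' => h h'.1⟩
  have hI : M.Indep I := hH.indep_of_subset (hIA.trans hA) hIc.le
  have hIK : I ⊆ M.closure K := fun a ha => hcon a (hIA ha) (by rintro rfl; exact ha₀ ha)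
  -- `I` is independent of size `r - 1` and `K` has only `r - 1` elements, so both span the same
  -- flat. The closure of `I` lies in `H`, whereas `K` does not.
  have hcl : M.closure I = M.closure (M.closure K) := by
    refine (M.isRkFinite_set I).closure_eq_closure_of_subset_of_eRk_ge_eRk hIK ?_
    rw [M.eRk_closure_eq, hI.eRk_eq_encard]
    refine (M.eRk_le_encard K).trans ?_
    rw [← hIc] at hKc
    exact ((ENat.add_left_injective_of_ne_top ENat.one_ne_top) hKc).le
  refine hK ((M.subset_closure K hKE).trans ?_)
  rw [M.closure_closure] at hcl
  rw [← hcl]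
  have := M.closure_subset_closure (hIA.trans hA)
  rwa [hH.1.1.closure] at this

theorem isBase_swap_of_notMem_closure [M.Finite] {B : Set α} (hB : M.IsBase B) {x a : α}
    (hx : x ∈ B) (ha : a ∈ M.E) (haB : a ∉ M.closure (B \ {x})) :
    M.IsBase (insert a (B \ {x})) :=
  isBase_insert_of_notMem (hB.indep.subset sdiff_subset)
    (by rw [encard_sdiff_singleton_add_one hx, hB.encard_eq_eRank]) ha haB

/-- An element of `H` can be exchanged into a base having two elements outside `H`, removing one
of these. -/
theorem IsStressedHyperplane.exists_isBase_swap [M.Finite] (hH : IsStressedHyperplane M H)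
    {B : Set α} (hB : M.IsBase B) (hBH : (B \ H).Nontrivial) {c : α} (hc : c ∈ H) (hcB : c ∉ B) :
    ∃ x ∈ B \ H, M.IsBase (insert c (B \ {x})) := by
  have hcE : c ∈ M.E := hH.1.1.subset_ground hc
  obtain ⟨x, hx, y, hy, hxy⟩ := hBH
  -- Two elements of `B` lie outside `H`, so even with `c` added the part inside `H` has fewer than
  -- `r` elements.
  have hind : M.Indep (insert c (B ∩ H)) := by
    refine hH.indep_of_subset (insert_subset hc inter_subset_right) ?_
    rw [encard_insert_of_notMem (fun h => hcB h.1), ← hB.encard_eq_eRank,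
      ← encard_sdiff_singleton_add_one hx.1,
      ← encard_sdiff_singleton_add_one (show y ∈ B \ {x} from ⟨hy.1, hxy.symm⟩)]
    gcongr
    rintro z ⟨hz, hzH⟩
    refine ⟨⟨hz, ?_⟩, ?_⟩
    · rintro rfl; exact hx.2 hzH
    · rintro rfl; exact hy.2 hzH
  by_contra! hcon
  -- Closures of subsets of an independent set intersect in the closure of the intersection. If no
  -- exchange were possible, `c` would thus be spanned by `B ∩ H`.
  have key : c ∈ M.closure (⋂ z : (B \ H : Set α), B \ {z.1}) := by
    have : Nonempty (B \ H : Set α) := ⟨⟨x, hx⟩⟩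
    rw [Matroid.closure_iInter_eq_iInter_closure_of_iUnion_indep]
    · rw [mem_iInter]
      intro z
      by_contra h
      exact hcon z.1 z.2 (isBase_swap_of_notMem_closure hB z.2.1 hcE h)
    · exact hB.indep.subset (iUnion_subset fun _ => sdiff_subset)
  have hsub : (⋂ z : (B \ H : Set α), B \ {z.1}) ⊆ B ∩ H := by
    intro w hw
    rw [mem_iInter] at hw
    refine ⟨(hw ⟨x, hx⟩).1, ?_⟩
    by_contra hwH
    exact (hw ⟨w, (hw ⟨x, hx⟩).1, hwH⟩).2 rfl
  have h1 := M.closure_subset_closure hsub key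
  exact ((hind.subset (subset_insert _ _)).notMem_closure_iff_of_notMem
    (fun h => hcB h.1) hcE).2 hind h1

/-! ### Exchanges between tuples of sets -/

/-- `C` arises from `B` by swapping `a ∈ B i` with `b ∈ B j`. -/
structure Swaps (B C : Fin n → Set α) (i j : Fin n) (a b : α) : Prop where
  ne : i ≠ j
  mem_left : a ∈ B i
  notMem_right : a ∉ B j
  mem_right : b ∈ B j
  notMem_left : b ∉ B i
  left : C i = insert b (B i \ {a})
  right : C j = insert a (B j \ {b})
  rest : ∀ k, k ≠ i → k ≠ j → C k = B k

theorem Swaps.symm {B C : Fin n → Set α} {i j : Fin n} {a b : α} (h : Swaps B C i j a b) :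
    Swaps B C j i b a :=
  ⟨h.ne.symm, h.mem_right, h.notMem_left, h.mem_left, h.notMem_right, h.right, h.left,
    fun k h1 h2 => h.rest k h2 h1⟩

theorem Swaps.reverse {B C : Fin n → Set α} {i j : Fin n} {a b : α} (h : Swaps B C i j a b) :
    Swaps C B i j b a := by
  obtain ⟨hne, h1, h2, h3, h4, h5, h6, h7⟩ := h
  have hab : a ≠ b := by rintro rfl; exact h2 h3
  refine ⟨hne, ?_, ?_, ?_, ?_, ?_, ?_, fun k hi hj => (h7 k hi hj).symm⟩
  · rw [h5]; exact mem_insert _ _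
  · rw [h6]; rintro (h | h)
    · exact hab h.symm
    · exact h.2 rfl
  · rw [h6]; exact mem_insert _ _
  · rw [h5]; rintro (h | h)
    · exact hab h
    · exact h.2 rfl
  · rw [h5]; ext x; simp only [mem_insert_iff, mem_sdiff, mem_singleton_iff]; grind
  · rw [h6]; ext x; simp only [mem_insert_iff, mem_sdiff, mem_singleton_iff]; grind

/-- The tuple obtained from `B` by swapping `a ∈ B i` with `b ∈ B j`. -/
def swapAt (B : Fin n → Set α) (i j : Fin n) (a b : α) : Fin n → Set α := fun k =>
  if k = i then insert b (B i \ {a}) else if k = j then insert a (B j \ {b}) else B k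

theorem swaps_swapAt {B : Fin n → Set α} {i j : Fin n} {a b : α} (hij : i ≠ j) (ha : a ∈ B i)
    (ha' : a ∉ B j) (hb : b ∈ B j) (hb' : b ∉ B i) : Swaps B (swapAt B i j a b) i j a b where
  ne := hij
  mem_left := ha
  notMem_right := ha'
  mem_right := hb
  notMem_left := hb'
  left := by simp [swapAt]
  right := by simp [swapAt, hij.symm]
  rest k h1 h2 := by simp [swapAt, h1, h2]

/-- `B` and `C` are tuples of sets satisfying `P` that differ by one symmetric exchange. -/
def Step (P : Set α → Prop) (B C : Fin n → Set α) : Prop :=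
  (∀ i, P (B i)) ∧ (∀ i, P (C i)) ∧ ∃ i j a b, Swaps B C i j a b

theorem Step.symm {B C : Fin n → Set α} (h : Step P B C) : Step P C B := by
  obtain ⟨h1, h2, i, j, a, b, h⟩ := h
  exact ⟨h2, h1, i, j, b, a, h.reverse⟩

theorem Step.mono {B C : Fin n → Set α} (hPQ : ∀ X, P X → Q X) (h : Step P B C) : Step Q B C :=
  ⟨fun i => hPQ _ (h.1 i), fun i => hPQ _ (h.2.1 i), h.2.2⟩

theorem Swaps.step {B C : Fin n → Set α} {i j : Fin n} {a b : α} (h : Swaps B C i j a b)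
    (hB : ∀ k, P (B k)) (hi : P (C i)) (hj : P (C j)) : Step P B C := by
  refine ⟨hB, fun k => ?_, i, j, a, b, h⟩
  by_cases hki : k = i
  · rwa [hki]
  by_cases hkj : k = j
  · rwa [hkj]
  rw [h.rest k hki hkj]
  exact hB k

theorem exchangeStep_of_step {N : Matroid α} {B C : Fin n → Set α} (h : Step N.IsBase B C) :
    ExchangeStep N B C := by
  obtain ⟨-, h2, i, j, a, b, h⟩ := h
  exact ⟨i, j, h.ne, a, ⟨h.mem_left, h.notMem_right⟩, b, ⟨h.mem_right, h.notMem_left⟩, h.left,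
    h2 i, h.right, h2 j, h.rest⟩

theorem step_of_exchangeStep {N : Matroid α} {B C : Fin n → Set α} (hB : IsBaseTuple N B)
    (h : ExchangeStep N B C) : Step N.IsBase B C := by
  obtain ⟨i, j, hij, a, ha, b, hb, h1, h2, h3, h4, h5⟩ := h
  exact Swaps.step ⟨hij, ha.1, ha.2, hb.1, hb.2, h1, h3, h5⟩ hB h2 h4

/-- The condition on `B` is listed separately because a chain without steps says nothing about its
only tuple. -/
theorem exchangeConnected_iff {N : Matroid α} {B C : Fin n → Set α} :
    ExchangeConnected N B C ↔ IsBaseTuple N B ∧ Relation.ReflTransGen (Step N.IsBase) B C := by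
  constructor
  · rintro ⟨l, T, rfl, rfl, h1, h2⟩
    refine ⟨h1 0 l.zero_le, ?_⟩
    suffices h : ∀ t ≤ l, Relation.ReflTransGen (Step N.IsBase) (T 0) (T t) from h l le_rfl
    intro t
    induction t with
    | zero => exact fun _ => .refl
    | succ t ih =>
      intro ht
      exact (ih (by omega)).tail (step_of_exchangeStep (h1 t (by omega)) (h2 t (by omega)))
  · rintro ⟨hB, h⟩
    induction h using Relation.ReflTransGen.head_induction_on with
    | refl => exact ⟨0, fun _ => C, rfl, rfl, fun _ _ => hB, by simp⟩
    | @head D _ h _ ih =>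
      obtain ⟨l, T, rfl, hl, h1, h2⟩ := ih h.2.1
      refine ⟨l + 1, fun t => Nat.casesOn t D T, rfl, hl, ?_, ?_⟩
      · rintro (_ | t) ht
        · exact hB
        · exact h1 t (by omega)
      · rintro (_ | t) ht
        · exact exchangeStep_of_step h
        · exact h2 t (by omega)

theorem exchangeConnectedIn_two {N : Matroid α} {A B C : Fin n → Set α}
    (h1 : Step N.IsBase A B) (h2 : Step N.IsBase B C) : ExchangeConnectedIn N 2 A C := by
  refine ⟨fun t => if t = 0 then A else if t = 1 then B else C, by simp, by simp, ?_, ?_⟩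
  · intro t ht
    interval_cases t
    exacts [h1.1, h1.2.1, h2.2.1]
  · intro t ht
    interval_cases t
    exacts [exchangeStep_of_step h1, exchangeStep_of_step h2]

/-! ### Changing a tuple at some positions only -/

-- Exchanges among positions selected by `f` become exchanges of the whole tuple, with `T` supplying
-- the remaining entries. In this way arguments in degree two and three, and (*), act inside tuples
-- of any degree.
open Function in
theorem Swaps.extend {f : Fin m → Fin n} (hf : Injective f) {S S' : Fin m → Set α}
    {i j : Fin m} {a b : α} (h : Swaps S S' i j a b) (T : Fin n → Set α) :
    Swaps (extend f S T) (extend f S' T) (f i) (f j) a b := by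
  obtain ⟨h0, h1, h2, h3, h4, h5, h6, h7⟩ := h
  refine ⟨hf.ne h0, ?_, ?_, ?_, ?_, ?_, ?_, ?_⟩
  iterate 6 simpa only [hf.extend_apply]
  intro k hki hkj
  by_cases hk : ∃ l, f l = k
  · obtain ⟨l, rfl⟩ := hk
    rw [hf.extend_apply, hf.extend_apply]
    exact h7 l (fun h => hki (h ▸ rfl)) (fun h => hkj (h ▸ rfl))
  · rw [extend_apply' _ _ _ hk, extend_apply' _ _ _ hk]

theorem Swaps.comp {f : Fin m → Fin n} (hf : Function.Injective f) {T T' : Fin n → Set α}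
    {i j : Fin m} {a b : α} (h : Swaps T T' (f i) (f j) a b) :
    Swaps (T ∘ f) (T' ∘ f) i j a b :=
  ⟨fun hij => h.ne (hij ▸ rfl), h.mem_left, h.notMem_right, h.mem_right, h.notMem_left, h.left,
    h.right, fun _ h1 h2 => h.rest _ (hf.ne h1) (hf.ne h2)⟩

theorem forall_extend {f : Fin m → Fin n} (hf : Function.Injective f) {S : Fin m → Set α}
    {T : Fin n → Set α} (hS : ∀ i, P (S i)) (hT : ∀ i, P (T i)) :
    ∀ k, P (Function.extend f S T k) := by
  intro k
  by_cases hk : ∃ l, f l = k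
  · obtain ⟨l, rfl⟩ := hk
    rw [hf.extend_apply]
    exact hS l
  · rw [Function.extend_apply' _ _ _ hk]
    exact hT k

theorem Step.extend {f : Fin m → Fin n} (hf : Function.Injective f) {S S' : Fin m → Set α}
    (h : Step P S S') {T : Fin n → Set α} (hT : ∀ i, P (T i)) :
    Step P (Function.extend f S T) (Function.extend f S' T) := by
  obtain ⟨h1, h2, i, j, a, b, h⟩ := h
  exact ⟨forall_extend hf h1 hT, forall_extend hf h2 hT, f i, f j, a, b, h.extend hf T⟩

theorem extend_comp_eq {f : Fin m → Fin n} (hf : Function.Injective f) {T T' : Fin n → Set α}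
    (h : ∀ k ∉ range f, T' k = T k) : Function.extend f (T' ∘ f) T = T' := by
  ext1 k
  by_cases hk : ∃ l, f l = k
  · obtain ⟨l, rfl⟩ := hk
    rw [hf.extend_apply]; rfl
  · rw [Function.extend_apply' _ _ _ hk]
    exact (h k hk).symm

theorem Step.extend_of_comp {f : Fin m → Fin n} (hf : Function.Injective f) {S : Fin m → Set α}
    {T : Fin n → Set α} (h : Step P (T ∘ f) S) (hT : ∀ i, P (T i)) :
    Step P T (Function.extend f S T) := by
  have := h.extend hf hT
  rwa [extend_comp_eq hf fun _ _ => rfl] at this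

/-! ### The number of entries contained in `H` -/

/-- The number of entries of `B` that are contained in `H`. -/
noncomputable def level (H : Set α) (B : Fin n → Set α) : ℕ := {i | B i ⊆ H}.ncard

theorem level_lt {B C : Fin n → Set α} {p : Fin n} (hp : B p ⊆ H) (hp' : ¬ C p ⊆ H)
    (h : ∀ q, C q ⊆ H → B q ⊆ H) : level H C < level H B :=
  ncard_lt_ncard (ssubset_of_subset_of_ne h fun he => hp' (he.symm ▸ hp : p ∈ {i | C i ⊆ H}))
    (toFinite _)

/-- If one position passes from `H` to the outside and another one in the converse direction, the
level does not change. -/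
theorem level_eq_of_exchange {B C : Fin n → Set α} {p q : Fin n} (hp : B p ⊆ H) (hp' : ¬ C p ⊆ H)
    (hq : ¬ B q ⊆ H) (hq' : C q ⊆ H) (h : ∀ k, k ≠ p → k ≠ q → (C k ⊆ H ↔ B k ⊆ H)) :
    level H C = level H B := by
  have h1 : {i | C i ⊆ H} = insert q ({i | B i ⊆ H} \ {p}) := by
    ext k
    simp only [mem_ofPred_eq, mem_insert_iff, mem_sdiff, mem_singleton_iff]
    by_cases hkp : k = p
    · subst hkp
      have : k ≠ q := by rintro rfl; exact hq hp
      simp [hp', this]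
    by_cases hkq : k = q
    · simp [hkq, hq']
    simp [hkp, hkq, h k hkp hkq]
  rw [level, level, h1]
  exact ncard_exchange hq hp

theorem Swaps.level_lt {B C : Fin n → Set α} {i j : Fin n} {a b : α} (h : Swaps B C i j a b)
    (hi : B i ⊆ H) (hb : b ∉ H) (hj : ¬ C j ⊆ H) : level H C < level H B := by
  have hCi : ¬ C i ⊆ H := by
    rw [h.left]; exact fun h' => hb (h' (mem_insert _ _))
  refine WhiteExchange.level_lt hi hCi fun q hq => ?_
  by_cases hqi : q = i
  · rwa [hqi]
  by_cases hqj : q = j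
  · exact absurd (hqj ▸ hq) hj
  rwa [← h.rest q hqi hqj]

/-- The form of an exchange that lowers the level. -/
theorem Step.exists_of_level_lt {B C : Fin n → Set α} (h : Step P B C)
    (hl : level H C < level H B) :
    ∃ i j a b, Swaps B C i j a b ∧ B i ⊆ H ∧ b ∉ H ∧ ¬ C j ⊆ H := by
  obtain ⟨-, -, i, j, a, b, h⟩ := h
  -- Some position must leave `H`; it is one of the two exchanged ones, and by symmetry it may be
  -- called `i`.
  obtain ⟨p, hp, hp'⟩ : ∃ p, B p ⊆ H ∧ ¬ C p ⊆ H := by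
    by_contra! hcon
    exact absurd hl (not_lt.2 (ncard_le_ncard hcon (toFinite _)))
  have key : ∀ i j a b, Swaps B C i j a b → p = i →
      ∃ i j a b, Swaps B C i j a b ∧ B i ⊆ H ∧ b ∉ H ∧ ¬ C j ⊆ H := by
    rintro i j a b h rfl
    have hb : b ∉ H := by
      intro hb
      refine hp' ?_
      rw [h.left]
      exact insert_subset hb (sdiff_subset.trans hp)
    -- If `j` ended inside `H`, it would have entered `H` by giving up `b`, compensating the loss at
    -- `p`.
    refine ⟨p, j, a, b, h, hp, hb, fun hj => hl.ne ?_⟩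
    refine level_eq_of_exchange hp hp' (fun hj' => hb (hj' h.mem_right)) hj fun k h1 h2 => ?_
    rw [h.rest k h1 h2]
  by_cases hpi : p = i
  · exact key _ _ _ _ h hpi
  by_cases hpj : p = j
  · exact key _ _ _ _ h.symm hpj
  exact absurd hp (h.rest p hpi hpj ▸ hp')

/-! ### Multiplicities -/

open Classical in
theorem multiUnion_apply (B : Fin n → Set α) (e : α) :
    multiUnion B e = ∑ i, if e ∈ B i then 1 else 0 := by
  rw [multiUnion, ncard_eq_toFinset_card', Finset.sum_boole]
  simp

theorem Swaps.multiUnion_eq {B C : Fin n → Set α} {i j : Fin n} {a b : α}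
    (h : Swaps B C i j a b) : multiUnion C = multiUnion B := by
  -- The element `a` merely moves from position `i` to position `j`; the symmetric exchange gives
  -- the same for `b`.
  have key : ∀ B C : Fin n → Set α, ∀ i j a b, Swaps B C i j a b →
      multiUnion C a = multiUnion B a := by
    intro B C i j a b h
    have h1 : {k | a ∈ C k} = insert j ({k | a ∈ B k} \ {i}) := by
      ext k
      simp only [mem_ofPred_eq, mem_insert_iff, mem_sdiff, mem_singleton_iff]
      by_cases hki : k = i
      · subst hki
        simp [h.ne, h.reverse.notMem_left]
      by_cases hkj : k = j
      · simp [hkj, h.reverse.mem_right]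
      simp [hki, hkj, h.rest k hki hkj]
    rw [multiUnion, multiUnion, h1]
    exact ncard_exchange h.notMem_right h.mem_left
  ext e
  by_cases hea : e = a
  · rw [hea]; exact key _ _ _ _ _ _ h
  by_cases heb : e = b
  · rw [heb]; exact key _ _ _ _ _ _ h.symm
  rw [multiUnion, multiUnion]
  congr 1
  ext k
  by_cases hki : k = i
  · simp [hki, h.left, hea, heb]
  by_cases hkj : k = j
  · simp [hkj, h.right, hea, heb]
  simp [h.rest k hki hkj]

theorem multiUnion_eq_of_reflTransGen {B C : Fin n → Set α}
    (h : Relation.ReflTransGen (Step P) B C) : multiUnion C = multiUnion B := by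
  induction h with
  | refl => rfl
  | tail _ h ih =>
    obtain ⟨-, -, i, j, a, b, h⟩ := h
    exact h.multiUnion_eq.trans ih

/-- The number of pairs of a position and an element outside `H` in the entry there. -/
noncomputable def outerCount (H : Set α) (B : Fin n → Set α) : ℕ := ∑ i, (B i \ H).ncard

/-- Double counting: `outerCount` is the sum of the multiplicities of the elements outside `H`. The
finite set `F` containing all entries makes this a finite sum. -/
theorem outerCount_eq_of_multiUnion_eq {B C : Fin n → Set α} (hB : ∀ i, (B i).Finite)
    (hC : ∀ i, (C i).Finite) (h : multiUnion B = multiUnion C) :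
    outerCount H B = outerCount H C := by
  classical
  obtain ⟨F, hF⟩ := ((finite_iUnion hB).union (finite_iUnion hC)).exists_finset_coe
  have key : ∀ D : Fin n → Set α, (∀ i, D i ⊆ F) →
      outerCount H D = ∑ e ∈ F with e ∉ H, multiUnion D e := by
    intro D hD
    simp only [multiUnion_apply]
    rw [Finset.sum_comm, outerCount]
    refine Finset.sum_congr rfl fun i _ => ?_
    rw [Finset.sum_boole, Nat.cast_id, ← ncard_coe_finset]
    congr 1
    ext e
    simp only [mem_sdiff, Finset.coe_filter, Finset.mem_filter, mem_ofPred_eq]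
    exact ⟨fun h => ⟨⟨hD i h.1, h.2⟩, h.1⟩, fun h => ⟨h.2, h.1.2⟩⟩
  rw [key B, key C, h]
  · intro i; rw [hF]; exact (subset_iUnion C i).trans subset_union_right
  · intro i; rw [hF]; exact (subset_iUnion B i).trans subset_union_left

theorem le_outerCount {B : Fin n → Set α} (hfin : ∀ i, (B i).Finite) (hB : ∀ i, ¬ B i ⊆ H) :
    n ≤ outerCount H B := by
  have : ∑ _i : Fin n, 1 ≤ outerCount H B := by
    refine Finset.sum_le_sum fun i _ => ?_
    rw [Nat.one_le_iff_ne_zero, Ne, ncard_eq_zero ((hfin i).subset sdiff_subset),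
      sdiff_eq_empty]
    exact hB i
  simpa using this

theorem outerCount_lt {B : Fin n → Set α} {p : Fin n} (hp : B p ⊆ H)
    (hB : ∀ i, (B i \ H).Subsingleton) : outerCount H B < n := by
  have : outerCount H B < ∑ _i : Fin n, 1 := by
    refine Finset.sum_lt_sum (fun i _ => ?_) ⟨p, Finset.mem_univ _, ?_⟩
    · have := (hB i).finite.to_subtype
      exact ncard_le_one_iff_subsingleton.2 (hB i)
    · rw [sdiff_eq_empty.2 hp]
      simp
  simpa using this

theorem exists_subset_of_outerCount_lt {B : Fin n → Set α} (hfin : ∀ i, (B i).Finite)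
    (h : outerCount H B < n) : ∃ p, B p ⊆ H := by
  by_contra! hcon
  exact absurd h (not_lt.2 (le_outerCount hfin hcon))

/-- Pigeonhole: the entry at `p` contributes nothing, so another one contributes at least two. As
`outerCount` is invariant under exchanges, the hypothesis persists along exchange sequences. -/
theorem exists_nontrivial_of_le_outerCount {B : Fin n → Set α} (h : n ≤ outerCount H B)
    {p : Fin n} (hp : B p ⊆ H) : ∃ k, (B k \ H).Nontrivial := by
  by_contra! hcon
  exact absurd h (not_le.2 (outerCount_lt hp fun i => hcon i))

/-! ### Lowering the level -/

/-- The two halves of an exchange of `c ∈ A` with `x ∈ C`. On the side of `A` nothing has to be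
checked, since `x` becomes the only element outside `H`; the closure condition serves the side of
`C`. -/
theorem IsStressedHyperplane.isBase_of_notMem_closure [M.Finite] (hH : IsStressedHyperplane M H)
    {A C : Set α} {x c : α} (hA : A ⊆ H) (hAc : A.encard = M.eRank) (hC : M.IsBase C)
    (hx : x ∈ C) (hxH : x ∉ H) (hc : c ∈ A) (hcC : c ∉ M.closure (C \ {x})) :
    M.IsBase (insert x (A \ {c})) ∧ M.IsBase (insert c (C \ {x})) ∧ c ∉ C ∧ x ∉ A := by
  have hcH := hA hc
  refine ⟨hH.isBase_insert (sdiff_subset.trans hA)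
    (by rw [encard_sdiff_singleton_add_one hc, hAc]) (hC.subset_ground hx) hxH,
    isBase_swap_of_notMem_closure hC hx (hH.1.1.subset_ground hcH) hcC, fun h => hcC ?_,
    fun h => hxH (hA h)⟩
  refine M.mem_closure_of_mem ⟨h, ?_⟩ (sdiff_subset.trans hC.subset_ground)
  rintro rfl
  exact hxH hcH

/-- The second outer element `y` keeps `C \ {x}` from lying in `H`. Where no element has to be
avoided, `c₀` is filled in arbitrarily. -/
theorem IsStressedHyperplane.exists_notMem_closure_sdiff [M.Finite]
    (hH : IsStressedHyperplane M H) {A C : Set α} {x y : α} (hA : A ⊆ H)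
    (hAc : A.encard = M.eRank) (hC : M.IsBase C) (hx : x ∈ C) (hy : y ∈ C) (hyH : y ∉ H)
    (hxy : x ≠ y) (c₀ : α) : ∃ c ∈ A, c ≠ c₀ ∧ c ∉ M.closure (C \ {x}) :=
  hH.exists_notMem_closure (K := C \ {x}) hA hAc (fun h => hyH (h ⟨hy, hxy.symm⟩))
    (sdiff_subset.trans hC.subset_ground)
    (by rw [encard_sdiff_singleton_add_one hx, hC.encard_eq_eRank]) c₀

theorem IsRelaxedBase.of_isBase {B : Set α} (h : M.IsBase B) : IsRelaxedBase M H B := Or.inl h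

theorem not_subset_of_nontrivial_sdiff {X : Set α} (h : (X \ H).Nontrivial) : ¬ X ⊆ H :=
  fun h' => h.nonempty.ne_empty (sdiff_eq_empty.2 h')

/-- An entry contained in `H` can be exchanged with an entry having two elements outside `H`. -/
theorem exists_step_level_lt [M.Finite] (hH : IsStressedHyperplane M H) {T : Fin n → Set α}
    (hT : ∀ i, IsRelaxedBase M H (T i)) {p k : Fin n} (hp : T p ⊆ H)
    (hk : (T k \ H).Nontrivial) :
    ∃ T₁ c x, Swaps T T₁ p k c x ∧ x ∉ H ∧ M.IsBase (T₁ p) ∧ M.IsBase (T₁ k) ∧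
      Step (IsRelaxedBase M H) T T₁ ∧ level H T₁ < level H T := by
  have hkH := not_subset_of_nontrivial_sdiff hk
  have hkM := (hT k).isBase hkH
  have hpk : p ≠ k := by rintro rfl; exact hkH hp
  obtain ⟨x, ⟨hx, hxH⟩, y, ⟨hy, hyH⟩, hxy⟩ := hk
  obtain ⟨c, hc, -, hcl⟩ :=
    hH.exists_notMem_closure_sdiff hp (hT p).encard_eq hkM hx hy hyH hxy x
  obtain ⟨h1, h2, h3, h4⟩ :=
    hH.isBase_of_notMem_closure hp (hT p).encard_eq hkM hx hxH hc hcl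
  have hs := swaps_swapAt hpk hc h3 hx h4
  have h1' : M.IsBase (swapAt T p k c x p) := by rwa [hs.left]
  have h2' : M.IsBase (swapAt T p k c x k) := by rwa [hs.right]
  exact ⟨_, c, x, hs, hxH, h1', h2', hs.step hT (.of_isBase h1') (.of_isBase h2'),
    hs.level_lt hp hxH (hH.not_isBase_subset h2')⟩

/-- Lowering the level stops only when there is no entry inside `H` or no entry with two elements
outside `H`. -/
theorem exists_reflTransGen_isBase_or_subsingleton [M.Finite] (hH : IsStressedHyperplane M H)
    (T : Fin n → Set α) (hT : ∀ i, IsRelaxedBase M H (T i)) :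
    ∃ T', Relation.ReflTransGen (Step (IsRelaxedBase M H)) T T' ∧
      (∀ i, IsRelaxedBase M H (T' i)) ∧
      ((∀ i, M.IsBase (T' i)) ∨ ((∃ p, T' p ⊆ H) ∧ ∀ i, (T' i \ H).Subsingleton)) := by
  induction hl : level H T using Nat.strong_induction_on generalizing T with
  | _ l ih =>
    by_cases hp : ∃ p, T p ⊆ H
    · by_cases hk : ∃ k, (T k \ H).Nontrivial
      · obtain ⟨p, hp⟩ := hp
        obtain ⟨k, hk⟩ := hk
        obtain ⟨T₁, -, -, -, -, -, -, hs, hlt⟩ := exists_step_level_lt hH hT hp hk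
        obtain ⟨T', h1, h2⟩ := ih _ (hl ▸ hlt) T₁ hs.2.1 rfl
        exact ⟨T', h1.head hs, h2⟩
      · push Not at hk
        exact ⟨T, .refl, hT, Or.inr ⟨hp, hk⟩⟩
    · push Not at hp
      exact ⟨T, .refl, hT, Or.inl fun i => (hT i).isBase (hp i)⟩

/-! ### Tuples of sets with at most one element outside `H` -/

/-- The sets of the size of a base of `M` with at most one element outside `H`. -/
def IsThin (M : Matroid α) (H X : Set α) : Prop :=
  X ⊆ M.E ∧ X.encard = M.eRank ∧ (X \ H).Subsingleton

theorem IsThin.isRelaxedBase [M.Finite] (hH : IsStressedHyperplane M H) {X : Set α}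
    (hX : IsThin M H X) : IsRelaxedBase M H X := by
  obtain ⟨h1, h2, h3⟩ := hX
  by_cases h : X ⊆ H
  · exact Or.inr ⟨h, h2⟩
  · obtain ⟨x, hx, hxH⟩ := not_subset.1 h
    refine Or.inl (hH.isBase_of_subset_insert (fun y hy => ?_) hx h2 (h1 hx) hxH)
    by_cases hyH : y ∈ H
    · exact Or.inr hyH
    · exact Or.inl (h3 ⟨hy, hyH⟩ ⟨hx, hxH⟩)

/-- The side condition says that the incoming element is in `H`, or that the outgoing one takes the
only possible outer element with it. -/
theorem IsThin.swap {X : Set α} (hX : IsThin M H X) {a b : α} (ha : a ∈ X) (hb : b ∉ X)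
    (hbE : b ∈ M.E) (h : b ∈ H ∨ X \ H ⊆ {a}) : IsThin M H (insert b (X \ {a})) := by
  refine ⟨insert_subset hbE (sdiff_subset.trans hX.1), (encard_swap ha hb).trans hX.2.1, ?_⟩
  rcases h with h | h
  · refine hX.2.2.anti ?_
    rintro y ⟨rfl | hy, hyH⟩
    · exact absurd h hyH
    · exact ⟨hy.1, hyH⟩
  · refine (subsingleton_singleton (a := b)).anti ?_
    rintro y ⟨rfl | hy, hyH⟩
    · rfl
    · exact absurd (h ⟨hy.1, hyH⟩) hy.2

theorem IsThin.finite [M.Finite] {X : Set α} (hX : IsThin M H X) : X.Finite :=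
  M.set_finite X hX.1

theorem IsThin.exists_mem_sdiff [M.Finite] {X Y : Set α} (hX : IsThin M H X) (hY : IsThin M H Y)
    {x : α} (hx : x ∈ X) (hxY : x ∉ Y) : ∃ y ∈ Y, y ∉ X := by
  by_contra! h
  have := hY.finite.eq_of_subset_of_encard_le h (hX.2.1.trans hY.2.1.symm).le
  exact hxY (this.symm ▸ hx)

theorem exists_mem_of_multiUnion_eq {B C : Fin n → Set α} (h : multiUnion B = multiUnion C)
    {i : Fin n} {e : α} (he : e ∈ C i) : ∃ j, e ∈ B j := by
  by_contra! hcon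
  have h1 : multiUnion C e = 0 := by
    rw [← h, multiUnion]
    simp [hcon]
  rw [multiUnion, ncard_eq_zero] at h1
  exact (h1 ▸ he : i ∈ (∅ : Set (Fin n)))

theorem exists_notMem_of_multiUnion_eq {B C : Fin n → Set α} (h : multiUnion B = multiUnion C)
    {i : Fin n} {e : α} (he : e ∉ C i) : ∃ j, e ∉ B j := by
  by_contra! hcon
  have h1 : {i | e ∈ C i}.ncard = (univ : Set (Fin n)).ncard := by
    rw [show (univ : Set (Fin n)) = {i | e ∈ B i} by ext; simp [hcon]]
    exact (congrFun h e).symm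
  have h2 := eq_of_subset_of_ncard_le (subset_univ {i | e ∈ C i}) h1.ge
  exact he (h2.symm ▸ mem_univ i : i ∈ {i | e ∈ C i})

/-- One exchange between thin tuples makes the elements outside `H` of the first entry agree with
those of a given tuple. -/
theorem exists_sdiff_eq [M.Finite] {B C : Fin (n + 1) → Set α} (hB : ∀ i, IsThin M H (B i))
    (hC : ∀ i, IsThin M H (C i)) (h : multiUnion B = multiUnion C) :
    ∃ B', Relation.ReflTransGen (Step (IsThin M H)) B B' ∧ (∀ i, IsThin M H (B' i)) ∧
      B' 0 \ H = C 0 \ H := by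
  by_cases hCH : C 0 ⊆ H
  · by_cases hBH : B 0 ⊆ H
    · exact ⟨B, .refl, hB, by rw [sdiff_eq_empty.2 hBH, sdiff_eq_empty.2 hCH]⟩
    obtain ⟨y, hy, hyH⟩ := not_subset.1 hBH
    -- The thin tuple `C` has an entry inside `H`, so its `outerCount` is below the degree. The same
    -- then holds for `B`, and some entry of `B` has room for `y`.
    obtain ⟨j, hj⟩ : ∃ j, B j ⊆ H := by
      refine exists_subset_of_outerCount_lt (fun i => (hB i).finite) ?_
      rw [outerCount_eq_of_multiUnion_eq (fun i => (hB i).finite) (fun i => (hC i).finite) h]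
      exact outerCount_lt hCH fun i => (hC i).2.2
    have hyj : y ∉ B j := fun h => hyH (hj h)
    obtain ⟨b, hb, hb0⟩ := (hB 0).exists_mem_sdiff (hB j) hy hyj
    have h0j : (0 : Fin (n + 1)) ≠ j := by rintro rfl; exact hBH hj
    have hs := swaps_swapAt h0j hy hyj hb hb0
    have hst : Step (IsThin M H) B (swapAt B 0 j y b) := by
      refine hs.step hB ?_ ?_
      · rw [hs.left]
        exact (hB 0).swap hy hb0 ((hB j).1 hb) (Or.inl (hj hb))
      · rw [hs.right]
        exact (hB j).swap hb hyj ((hB 0).1 hy) (Or.inr (by rw [sdiff_eq_empty.2 hj]; simp))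
    refine ⟨_, .single hst, hst.2.1, ?_⟩
    rw [hs.left, sdiff_eq_empty.2 hCH, sdiff_eq_empty]
    refine insert_subset (hj hb) ?_
    rintro z ⟨hz, hzy⟩
    by_contra hzH
    exact hzy ((hB 0).2.2 ⟨hz, hzH⟩ ⟨hy, hyH⟩)
  · obtain ⟨x, hx, hxH⟩ := not_subset.1 hCH
    have hCx : C 0 \ H = {x} := (hC 0).2.2.eq_singleton_of_mem ⟨hx, hxH⟩
    by_cases hx0 : x ∈ B 0
    · exact ⟨B, .refl, hB, by rw [hCx, (hB 0).2.2.eq_singleton_of_mem ⟨hx0, hxH⟩]⟩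
    obtain ⟨j, hj⟩ := exists_mem_of_multiUnion_eq h hx
    have hjx : B j \ H = {x} := (hB j).2.2.eq_singleton_of_mem ⟨hj, hxH⟩
    -- The element given up is the outer element of `B 0` whenever there is one, so that `B 0` stays
    -- thin on receiving `x`.
    obtain ⟨a, ha, haj, ha0⟩ : ∃ a ∈ B 0, a ∉ B j ∧ B 0 \ H ⊆ {a} := by
      by_cases hBH : B 0 ⊆ H
      · obtain ⟨a, ha, haj⟩ := (hB j).exists_mem_sdiff (hB 0) hj hx0
        exact ⟨a, ha, haj, by rw [sdiff_eq_empty.2 hBH]; simp⟩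
      · obtain ⟨y, hy, hyH⟩ := not_subset.1 hBH
        refine ⟨y, hy, fun h' => hx0 ?_, ((hB 0).2.2.eq_singleton_of_mem ⟨hy, hyH⟩).subset⟩
        rwa [← (hB j).2.2 ⟨h', hyH⟩ ⟨hj, hxH⟩]
    have h0j : (0 : Fin (n + 1)) ≠ j := by rintro rfl; exact hx0 hj
    have hs := swaps_swapAt h0j ha haj hj hx0
    have hst : Step (IsThin M H) B (swapAt B 0 j a x) := by
      refine hs.step hB ?_ ?_
      · rw [hs.left]
        exact (hB 0).swap ha hx0 ((hB j).1 hj) (Or.inr ha0)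
      · rw [hs.right]
        exact (hB j).swap hj haj ((hB 0).1 ha) (Or.inr hjx.subset)
    refine ⟨_, .single hst, hst.2.1, ?_⟩
    rw [hCx]
    refine (hst.2.1 0).2.2.eq_singleton_of_mem ⟨?_, hxH⟩
    rw [hs.left]
    exact mem_insert _ _

/-- Since the outer parts agree, `B 0` and `C 0` differ only inside `H`, and the difference is
removed one element at a time. To trade `a` for `c` at position `0`, an entry with `c` but without
`a` is needed. If there is none, some entry contains both and another contains neither; moving `a`
from the former to the latter creates the required entry. -/
theorem exists_eq_zero [M.Finite] (hHE : H ⊆ M.E) {C : Fin (n + 1) → Set α}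
    (hC : ∀ i, IsThin M H (C i)) (B : Fin (n + 1) → Set α) (hB : ∀ i, IsThin M H (B i))
    (h : multiUnion B = multiUnion C) (h0 : B 0 \ H = C 0 \ H) :
    ∃ B', Relation.ReflTransGen (Step (IsThin M H)) B B' ∧ (∀ i, IsThin M H (B' i)) ∧
      B' 0 = C 0 := by
  induction hd : (C 0 \ B 0).ncard generalizing B with
  | zero =>
    rw [ncard_eq_zero ((hC 0).finite.subset sdiff_subset), sdiff_eq_empty] at hd
    exact ⟨B, .refl, hB, ((hC 0).finite.eq_of_subset_of_encard_le hd
      ((hB 0).2.1.trans (hC 0).2.1.symm).le).symm⟩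
  | succ d ih =>
    obtain ⟨c, hc, hcB⟩ : (C 0 \ B 0).Nonempty := by
      rw [nonempty_iff_ne_empty]
      intro he
      simp [he] at hd
    obtain ⟨a, ha, haC⟩ := (hC 0).exists_mem_sdiff (hB 0) hc hcB
    have hcH : c ∈ H := by
      by_contra hcH
      exact hcB (h0 ▸ (⟨hc, hcH⟩ : c ∈ C 0 \ H) : c ∈ B 0 \ H).1
    have haH : a ∈ H := by
      by_contra haH
      exact haC (h0 ▸ (⟨ha, haH⟩ : a ∈ B 0 \ H) : a ∈ C 0 \ H).1
    -- once `c` lies in an entry without `a`, the exchange can be made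
    have key : ∀ D : Fin (n + 1) → Set α, (∀ i, IsThin M H (D i)) → D 0 = B 0 →
        multiUnion D = multiUnion C → (∃ j, c ∈ D j ∧ a ∉ D j) →
        ∃ B', Relation.ReflTransGen (Step (IsThin M H)) D B' ∧ (∀ i, IsThin M H (B' i)) ∧
          B' 0 = C 0 := by
      rintro D hD hD0 hDC ⟨j, hj, haj⟩
      have h0j : (0 : Fin (n + 1)) ≠ j := by rintro rfl; exact hcB (hD0 ▸ hj)
      rw [← hD0] at ha hcB
      have hs := swaps_swapAt h0j ha haj hj hcB
      have hst : Step (IsThin M H) D (swapAt D 0 j a c) := by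
        refine hs.step hD ?_ ?_
        · rw [hs.left]
          exact (hD 0).swap ha hcB (hHE hcH) (Or.inl hcH)
        · rw [hs.right]
          exact (hD j).swap hj haj (hHE haH) (Or.inl haH)
      obtain ⟨B', h1, h2⟩ := ih _ hst.2.1 (hs.multiUnion_eq.trans hDC) (by
        rw [hs.left, ← h0, ← hD0]
        ext z
        simp only [mem_insert_iff, mem_sdiff, mem_singleton_iff]
        grind) (by
        have h3 : C 0 \ B 0 = insert c (C 0 \ swapAt D 0 j a c 0) := by
          rw [hs.left, ← hD0]
          ext z
          simp only [mem_insert_iff, mem_sdiff, mem_singleton_iff]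
          grind
        rw [h3, ncard_insert_of_notMem (by rw [hs.left]; simp)
          ((hC 0).finite.subset sdiff_subset)] at hd
        omega)
      exact ⟨B', h1.head hst, h2⟩
    by_cases hj : ∃ j, c ∈ B j ∧ a ∉ B j
    · exact key B hB rfl h hj
    push Not at hj
    obtain ⟨j, hcj⟩ := exists_mem_of_multiUnion_eq h hc
    obtain ⟨k, hak⟩ := exists_notMem_of_multiUnion_eq h haC
    have haj := hj j hcj
    have hck : c ∉ B k := fun h' => hak (hj k h')
    have hjk : j ≠ k := by rintro rfl; exact hak haj
    have hac : a ≠ c := by rintro rfl; exact hcB ha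
    -- `B j \ B k` contains `a` and `c`, so `B k \ B j` also has at least two elements, and at most
    -- one of them is outside `H`.
    obtain ⟨e, hek, hej, heH⟩ : ∃ e ∈ B k, e ∉ B j ∧ e ∈ H := by
      obtain ⟨e, hek, hej⟩ := (hB j).exists_mem_sdiff (hB k) haj hak
      by_cases heH : e ∈ H
      · exact ⟨e, hek, hej, heH⟩
      have h1 : (insert e (B j \ {a})).encard = M.eRank := (encard_swap haj hej).trans (hB j).2.1
      obtain ⟨f, hfk, hf⟩ : ∃ f ∈ B k, f ∉ insert e (B j \ {a}) := by
        by_contra! hcon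
        have h2 := (hB k).finite.eq_of_subset_of_encard_le hcon
          (h1.trans (hB k).2.1.symm).le
        exact hck (h2.symm ▸ Or.inr ⟨hcj, hac.symm⟩)
      have hfe : f ≠ e := fun h => hf (Or.inl h)
      refine ⟨f, hfk, fun hfj => hf (Or.inr ⟨hfj, ?_⟩), ?_⟩
      · rintro rfl; exact hak hfk
      · by_contra hfH
        exact hfe ((hB k).2.2 ⟨hfk, hfH⟩ ⟨hek, heH⟩)
    have hs := swaps_swapAt hjk haj hak hek hej
    have hst : Step (IsThin M H) B (swapAt B j k a e) := by
      refine hs.step hB ?_ ?_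
      · rw [hs.left]
        exact (hB j).swap haj hej (hHE heH) (Or.inl heH)
      · rw [hs.right]
        exact (hB k).swap hek hak (hHE haH) (Or.inl haH)
    obtain ⟨B', h1, h2⟩ := key _ hst.2.1
      (hs.rest 0 (by rintro rfl; exact hcB hcj) (by rintro rfl; exact hak ha))
      (hs.multiUnion_eq.trans h) ⟨j, by rw [hs.left]; exact Or.inr ⟨hcj, hac.symm⟩, by
        rw [hs.left]
        rintro (rfl | h')
        · exact hak hek
        · exact h'.2 rfl⟩
    exact ⟨B', h1.head hst, h2⟩

/-- Thin tuples with the same multiset union are connected by exchanges between thin tuples. -/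
theorem IsThin.reflTransGen [M.Finite] (hHE : H ⊆ M.E) (B C : Fin n → Set α)
    (hB : ∀ i, IsThin M H (B i)) (hC : ∀ i, IsThin M H (C i))
    (h : multiUnion B = multiUnion C) : Relation.ReflTransGen (Step (IsThin M H)) B C := by
  induction n with
  | zero => rw [Subsingleton.elim B C]
  | succ n ih =>
    obtain ⟨B₁, h1, hB1, h10⟩ := exists_sdiff_eq hB hC h
    obtain ⟨B₂, h2, hB2, h20⟩ := exists_eq_zero hHE hC B₁ hB1
      ((multiUnion_eq_of_reflTransGen h1).trans h) h10
    refine (h1.trans h2).trans ?_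
    have hinj := Fin.succ_injective n
    have hrange : ∀ k ∉ range (Fin.succ : Fin n → Fin (n + 1)), k = 0 := by
      intro k hk
      by_contra hk0
      exact hk (Fin.exists_succ_eq.2 hk0)
    have h3 := ih (B₂ ∘ Fin.succ) (C ∘ Fin.succ) (fun i => hB2 _) (fun i => hC _) (by
      ext e
      have h4 := congrFun (((multiUnion_eq_of_reflTransGen h2).trans
        (multiUnion_eq_of_reflTransGen h1)).trans h) e
      rw [multiUnion_apply, multiUnion_apply, Fin.sum_univ_succ, Fin.sum_univ_succ, h20] at h4
      rw [multiUnion_apply, multiUnion_apply]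
      exact add_left_cancel h4)
    have h5 := h3.lift (p := Step (IsThin M H)) (fun S => Function.extend Fin.succ S B₂)
      (fun _ _ hs => hs.extend hinj hB2)
    simp only [Function.onFun] at h5
    rwa [extend_comp_eq hinj (fun _ _ => rfl), extend_comp_eq hinj (fun k hk => by
      rw [hrange k hk, h20])] at h5

/-! ### The first implication: from `M` to its relaxation -/

theorem reflTransGen_step_symm {P : Set α → Prop} {B C : Fin n → Set α}
    (h : Relation.ReflTransGen (Step P) B C) : Relation.ReflTransGen (Step P) C B := by
  induction h with
  | refl => exact .refl
  | tail _ h ih => exact ih.head h.symm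

/-- The invariant `outerCount` is at least `n` in one normal form and less than `n` in the other, so
both tuples reach the same one. -/
theorem whiteHolds_relaxation [M.Finite] (hH : IsStressedHyperplane M H) (hM : WhiteHolds M) :
    WhiteHolds (relaxation M H hH) := by
  intro n B C hB hC hBC
  rw [exchangeConnected_iff]
  refine ⟨hB, ?_⟩
  change Relation.ReflTransGen (Step (IsRelaxedBase M H)) B C
  obtain ⟨B', hBB', hB', hB''⟩ := exists_reflTransGen_isBase_or_subsingleton hH B hB
  obtain ⟨C', hCC', hC', hC''⟩ := exists_reflTransGen_isBase_or_subsingleton hH C hC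
  refine (hBB'.trans ?_).trans (reflTransGen_step_symm hCC')
  have hm : multiUnion B' = multiUnion C' := by
    rw [multiUnion_eq_of_reflTransGen hBB', hBC, multiUnion_eq_of_reflTransGen hCC']
  have hfin : ∀ {X}, IsRelaxedBase M H X → X.Finite :=
    fun h => M.set_finite _ (h.subset_ground hH)
  have ht : outerCount H B' = outerCount H C' :=
    outerCount_eq_of_multiUnion_eq (fun i => hfin (hB' i)) (fun i => hfin (hC' i)) hm
  have hle : ∀ D : Fin n → Set α, (∀ i, M.IsBase (D i)) → n ≤ outerCount H D := fun D hD =>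
    le_outerCount (fun i => M.set_finite _ (hD i).subset_ground)
      fun i => hH.not_isBase_subset (hD i)
  rcases hB'' with hB'' | ⟨⟨p, hp⟩, hB''⟩
  · rcases hC'' with hC'' | ⟨⟨q, hq⟩, hC''⟩
    · have := (exchangeConnected_iff.1 (hM n B' C' hB'' hC'' hm)).2
      exact Relation.ReflTransGen.mono (fun _ _ h => h.mono fun _ => .of_isBase) _ _ this
    · exact absurd (outerCount_lt hq hC'') (not_lt.2 (ht ▸ hle B' hB''))
  · rcases hC'' with hC'' | ⟨⟨q, hq⟩, hC''⟩
    · exact absurd (outerCount_lt hp hB'') (not_lt.2 (ht.symm ▸ hle C' hC''))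
    · have := IsThin.reflTransGen hH.1.1.subset_ground B' C'
        (fun i => ⟨(hB' i).subset_ground hH, (hB' i).encard_eq, hB'' i⟩)
        (fun i => ⟨(hC' i).subset_ground hH, (hC' i).encard_eq, hC'' i⟩) hm
      exact Relation.ReflTransGen.mono (fun _ _ h => h.mono fun _ h => h.isRelaxedBase hH) _ _ this

/-! ### Exchanges in tuples of degree two and three -/

theorem Step.of_two {A B A' B' : Set α} (a b : α) (hA : P A) (hB : P B) (hA' : P A') (hB' : P B')
    (h1 : a ∈ A) (h2 : a ∉ B) (h3 : b ∈ B) (h4 : b ∉ A) (h5 : A' = insert b (A \ {a}))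
    (h6 : B' = insert a (B \ {b})) : Step P ![A, B] ![A', B'] := by
  refine ⟨?_, ?_, 0, 1, a, b, by simp, h1, h2, h3, h4, h5, h6, ?_⟩
  · simp [Fin.forall_fin_two, hA, hB]
  · simp [Fin.forall_fin_two, hA', hB']
  · simp [Fin.forall_fin_two]

theorem Step.of_three_zero_one {A B C A' B' : Set α} (a b : α) (hA : P A) (hB : P B) (hC : P C)
    (hA' : P A') (hB' : P B') (h1 : a ∈ A) (h2 : a ∉ B) (h3 : b ∈ B) (h4 : b ∉ A)
    (h5 : A' = insert b (A \ {a})) (h6 : B' = insert a (B \ {b})) :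
    Step P ![A, B, C] ![A', B', C] := by
  refine ⟨?_, ?_, 0, 1, a, b, by simp, h1, h2, h3, h4, h5, h6, ?_⟩
  · simp [Fin.forall_fin_succ, hA, hB, hC]
  · simp [Fin.forall_fin_succ, hA', hB', hC]
  · simp [Fin.forall_fin_succ]

theorem Step.of_three_zero_two {A B C A' C' : Set α} (a c : α) (hA : P A) (hB : P B) (hC : P C)
    (hA' : P A') (hC' : P C') (h1 : a ∈ A) (h2 : a ∉ C) (h3 : c ∈ C) (h4 : c ∉ A)
    (h5 : A' = insert c (A \ {a})) (h6 : C' = insert a (C \ {c})) :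
    Step P ![A, B, C] ![A', B, C'] := by
  refine ⟨?_, ?_, 0, 2, a, c, by simp, h1, h2, h3, h4, h5, h6, ?_⟩
  · simp [Fin.forall_fin_succ, hA, hB, hC]
  · simp [Fin.forall_fin_succ, hA', hB, hC']
  · simp [Fin.forall_fin_succ]

theorem Step.of_three_one_two {A B C B' C' : Set α} (b c : α) (hA : P A) (hB : P B) (hC : P C)
    (hB' : P B') (hC' : P C') (h1 : b ∈ B) (h2 : b ∉ C) (h3 : c ∈ C) (h4 : c ∉ B)
    (h5 : B' = insert c (B \ {b})) (h6 : C' = insert b (C \ {c})) :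
    Step P ![A, B, C] ![A, B', C'] := by
  refine ⟨?_, ?_, 1, 2, b, c, by simp, h1, h2, h3, h4, h5, h6, ?_⟩
  · simp [Fin.forall_fin_succ, hA, hB, hC]
  · simp [Fin.forall_fin_succ, hA, hB', hC']
  · simp [Fin.forall_fin_succ]

/-- From each of `S` and `S'`, an exchange in the relaxation leads to a tuple of bases of `M`, and
these two tuples are connected by exchanges in `M`. -/
def JoinedInBases (M : Matroid α) (H : Set α) (S S' : Fin m → Set α) : Prop :=
  ∃ S₁ S₁', Step (IsRelaxedBase M H) S S₁ ∧ Step (IsRelaxedBase M H) S' S₁' ∧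
    (∀ i, M.IsBase (S₁ i)) ∧ Relation.ReflTransGen (Step M.IsBase) S₁ S₁'

theorem forall_of_reflTransGen_step {B C : Fin n → Set α}
    (h : Relation.ReflTransGen (Step P) B C) (hB : ∀ i, P (B i)) : ∀ i, P (C i) := by
  induction h with
  | refl => exact hB
  | tail _ h _ => exact h.2.1

theorem JoinedInBases.symm {S S' : Fin m → Set α} (h : JoinedInBases M H S S') :
    JoinedInBases M H S' S := by
  obtain ⟨S₁, S₁', h1, h2, h3, h4⟩ := h
  exact ⟨S₁', S₁, h2, h1, forall_of_reflTransGen_step h4 h3, reflTransGen_step_symm h4⟩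

/-- A swap, inside `H`, between a subset of `H` and a base with two elements outside `H`. -/
theorem joinedInBases_two [M.Finite] (hH : IsStressedHyperplane M H) {A B : Set α} {a b : α}
    (hA : A ⊆ H) (hAc : A.encard = M.eRank) (hB : M.IsBase B) (hBH : (B \ H).Nontrivial)
    (ha : a ∈ A) (haB : a ∉ B) (hb : b ∈ B) (hbA : b ∉ A) (hbH : b ∈ H)
    (hB' : M.IsBase (insert a (B \ {b}))) :
    JoinedInBases M H ![A, B] ![insert b (A \ {a}), insert a (B \ {b})] := by
  have haH := hA ha
  obtain ⟨x, ⟨hx, hxH⟩, hBx⟩ := hH.exists_isBase_swap hB hBH haH haB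
  have hxA : x ∉ A := fun h => hxH (hA h)
  have hax : a ≠ x := by rintro rfl; exact hxH haH
  have hbx : b ≠ x := by rintro rfl; exact hxH hbH
  have hab : a ≠ b := by rintro rfl; exact haB hb
  have hA₁ : M.IsBase (insert x (A \ {a})) :=
    hH.isBase_insert (sdiff_subset.trans hA)
      (by rw [encard_sdiff_singleton_add_one ha, hAc]) (hB.subset_ground hx) hxH
  have hA' : IsRelaxedBase M H (insert b (A \ {a})) :=
    Or.inr ⟨insert_subset hbH (sdiff_subset.trans hA), (encard_swap ha hbA).trans hAc⟩
  -- Both tuples reach this one in a single exchange: `x` enters the subset of `H` in place of `a`,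
  -- or in place of `b` after the swap.
  refine ⟨![insert x (A \ {a}), insert a (B \ {x})], ![insert x (A \ {a}), insert a (B \ {x})],
    ?_, ?_, by simp [Fin.forall_fin_two, hA₁, hBx], .refl⟩
  · exact .of_two a x (Or.inr ⟨hA, hAc⟩) (.of_isBase hB) (.of_isBase hA₁) (.of_isBase hBx) ha haB
      hx hxA rfl rfl
  · refine .of_two b x hA' (.of_isBase hB') (.of_isBase hA₁) (.of_isBase hBx) ?_ ?_ ?_ ?_ ?_ ?_
    · simp
    · simp [hab.symm]
    · simp [hx, hbx.symm]
    · simp [hxA, hbx.symm]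
    · ext z; simp only [mem_insert_iff, mem_sdiff, mem_singleton_iff]; grind
    · ext z; simp only [mem_insert_iff, mem_sdiff, mem_singleton_iff]; grind

/-- A swap that exchanges the roles of a subset `A` of `H` and a base `B` with exactly one element
outside `H`. -/
theorem joinedInBases_of_sdiff_eq_singleton [M.Finite] (hH : IsStressedHyperplane M H)
    {A B C : Set α} {a y : α} (hA : A ⊆ H) (hAc : A.encard = M.eRank) (hB : M.IsBase B)
    (hBy : B \ H = {y}) (hC : M.IsBase C) (hCH : (C \ H).Nontrivial) (ha : a ∈ A) (haB : a ∉ B) :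
    JoinedInBases M H ![A, B, C] ![insert y (A \ {a}), insert a (B \ {y}), C] := by
  obtain ⟨hy, hyH⟩ : y ∈ B \ H := hBy ▸ mem_singleton y
  obtain ⟨x, ⟨hx, hxH⟩, hxy⟩ := hCH.exists_ne y
  obtain ⟨w, ⟨hw, hwH⟩, hwx⟩ := hCH.exists_ne x
  have hBH : B \ {y} ⊆ H := by
    rintro z ⟨hz, hzy⟩
    by_contra hzH
    exact hzy (hBy ▸ (⟨hz, hzH⟩ : z ∈ B \ H) : z ∈ ({y} : Set α))
  have hxB : x ∉ B := fun h => hxH (hBH ⟨h, hxy⟩)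
  have hxA : x ∉ A := fun h => hxH (hA h)
  have hyA : y ∉ A := fun h => hyH (hA h)
  have haH := hA ha
  have hax : a ≠ x := by rintro rfl; exact hxH haH
  have hay : a ≠ y := by rintro rfl; exact hyH haH
  have hxE := hC.subset_ground hx
  have hyE := hB.subset_ground hy
  have hBc := hB.encard_eq_eRank
  have hCx : ∀ c, c ∉ M.closure (C \ {x}) → c ≠ x → c ∉ C := fun c hc hcx h =>
    hc (M.mem_closure_of_mem ⟨h, hcx⟩ (sdiff_subset.trans hC.subset_ground))
  have hCs : ∀ c, c ∈ H → c ∉ M.closure (C \ {x}) → M.IsBase (insert c (C \ {x})) :=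
    fun c hc hcl => isBase_swap_of_notMem_closure hC hx (hH.1.1.subset_ground hc) hcl
  have hAs : ∀ c ∈ A, ∀ z ∈ M.E, z ∉ H → M.IsBase (insert z (A \ {c})) := fun c hc z hz hzH =>
    hH.isBase_insert (sdiff_subset.trans hA)
      (by rw [encard_sdiff_singleton_add_one hc, hAc]) hz hzH
  have hBx : M.IsBase (insert x (B \ {y})) :=
    hH.isBase_insert hBH (by rw [encard_sdiff_singleton_add_one hy, hBc]) hxE hxH
  have hB'c : (insert a (B \ {y})).encard = M.eRank := (encard_swap hy haB).trans hBc
  have hB'H : insert a (B \ {y}) ⊆ H := insert_subset haH hBH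
  have hAr : IsRelaxedBase M H A := Or.inr ⟨hA, hAc⟩
  have hB'r : IsRelaxedBase M H (insert a (B \ {y})) := Or.inr ⟨hB'H, hB'c⟩
  have hA'r : IsRelaxedBase M H (insert y (A \ {a})) := .of_isBase (hAs a ha y hyE hyH)
  -- Both ends are lowered by passing some `c` to `C` in return for `x`: from `A` at the start, from
  -- the new subset of `H` at the end. The rest of the proof matches the choices of `c`.
  have hstart : ∀ c ∈ A, c ∉ M.closure (C \ {x}) → Step (IsRelaxedBase M H) ![A, B, C]
      ![insert x (A \ {c}), B, insert c (C \ {x})] := fun c hc hcl =>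
    .of_three_zero_two c x hAr (.of_isBase hB) (.of_isBase hC) (.of_isBase (hAs c hc x hxE hxH))
      (.of_isBase (hCs c (hA hc) hcl)) hc (hCx c hcl (by rintro rfl; exact hxH (hA hc))) hx hxA
      rfl rfl
  have hfirst : ∀ c ∈ A, c ∉ M.closure (C \ {x}) → Step M.IsBase
      ![insert x (A \ {c}), B, insert c (C \ {x})]
      ![insert y (A \ {c}), insert x (B \ {y}), insert c (C \ {x})] := fun c hc hcl =>
    .of_three_zero_one x y (hAs c hc x hxE hxH) hB (hCs c (hA hc) hcl) (hAs c hc y hyE hyH) hBx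
      (mem_insert _ _) hxB hy (by simp [hxy.symm, hyA]) (by simp [hxA]) rfl
  have hB'' : ∀ c ∈ insert a (B \ {y}), M.IsBase (insert x (insert a (B \ {y}) \ {c})) :=
    fun c hc => hH.isBase_insert (sdiff_subset.trans hB'H)
      (by rw [encard_sdiff_singleton_add_one hc, hB'c]) hxE hxH
  have hend : ∀ c ∈ insert a (B \ {y}), c ∉ M.closure (C \ {x}) → Step (IsRelaxedBase M H)
      ![insert y (A \ {a}), insert a (B \ {y}), C]
      ![insert y (A \ {a}), insert x (insert a (B \ {y}) \ {c}), insert c (C \ {x})] :=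
    fun c hc hcl => .of_three_one_two c x hA'r hB'r (.of_isBase hC) (.of_isBase (hB'' c hc))
      (.of_isBase (hCs c (hB'H hc) hcl)) hc (hCx c hcl (by rintro rfl; exact hxH (hB'H hc))) hx
      (fun h => hxH (hB'H h)) rfl rfl
  have hbases : ∀ c ∈ A, c ∉ M.closure (C \ {x}) →
      ∀ i, M.IsBase (![insert x (A \ {c}), B, insert c (C \ {x})] i) := fun c hc hcl => by
    simp [Fin.forall_fin_succ, hAs c hc x hxE hxH, hB, hCs c (hA hc) hcl]
  -- If `c = a` is admissible, swapping `x` and `y` already connects the two lowered tuples.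
  by_cases hacl : a ∈ M.closure (C \ {x})
  swap
  · refine ⟨_, _, hstart a ha hacl, hend a (mem_insert _ _) hacl, hbases a ha hacl, .single ?_⟩
    have : insert a (B \ {y}) \ {a} = B \ {y} := by simp [haB]
    rw [this]
    exact hfirst a ha hacl
  -- A common element `c` of `A` and `B` can be used at both ends; a swap of `a` and `c` is then
  -- added.
  by_cases h2 : ∃ c ∈ A, c ∈ B ∧ c ∉ M.closure (C \ {x})
  · obtain ⟨c, hc, hcB, hcl⟩ := h2
    have hcy : c ≠ y := by rintro rfl; exact hyA hc
    have hca : c ≠ a := by rintro rfl; exact haB hcB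
    have hcx : c ≠ x := by rintro rfl; exact hxA hc
    have hcB' : c ∈ insert a (B \ {y}) := Or.inr ⟨hcB, hcy⟩
    refine ⟨_, _, hstart c hc hcl, hend c hcB' hcl, hbases c hc hcl,
      .head (hfirst c hc hcl) (.single ?_)⟩
    refine .of_three_zero_one a c (hAs c hc y hyE hyH) hBx (hCs c (hA hc) hcl)
      (hAs a ha y hyE hyH) (hB'' c hcB') ?_ ?_ ?_ ?_ ?_ ?_
    · simp [ha, hca.symm]
    · simp [hax, haB]
    · simp [hcB, hcy]
    · simp [hcy]
    · ext z; simp only [mem_insert_iff, mem_sdiff, mem_singleton_iff]; grind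
    · ext z; simp only [mem_insert_iff, mem_sdiff, mem_singleton_iff]; grind
  -- Otherwise different elements `c` and `d` are passed to `C` at the two ends. After the swap of
  -- `x` and `y`, `a` is swapped with `d` between the first two entries, then `d` with `c` between
  -- the first and the third.
  · obtain ⟨c, hc, hca, hcl⟩ := hH.exists_notMem_closure_sdiff hA hAc hC hx hw hwH hwx.symm a
    obtain ⟨d, hd, hda, hdcl⟩ := hH.exists_notMem_closure_sdiff hB'H hB'c hC hx hw hwH hwx.symm a
    have hdB : d ∈ B := (hd.resolve_left hda).1
    have hdA : d ∉ A := fun h => h2 ⟨d, h, hdB, hdcl⟩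
    have hcB : c ∉ B := fun h => h2 ⟨c, hc, h, hcl⟩
    have hdH := hB'H hd
    have hdy : d ≠ y := by rintro rfl; exact hyH hdH
    have hdx : d ≠ x := by rintro rfl; exact hxH hdH
    have hcy : c ≠ y := by rintro rfl; exact hyA hc
    have hcx : c ≠ x := by rintro rfl; exact hxA hc
    have hcd : c ≠ d := by rintro rfl; exact hdA hc
    have hcC := hCx c hcl hcx
    have hdC := hCx d hdcl hdx
    have haA₂ : a ∈ insert y (A \ {c}) := Or.inr ⟨ha, hca.symm⟩
    have hdA₂ : d ∉ insert y (A \ {c}) := by simp [hdA, hdy]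
    have hA₂ : M.IsBase (insert d (insert y (A \ {c}) \ {a})) := by
      refine hH.isBase_of_subset_insert (x := y) ?_ ?_ ?_ hyE hyH
      · rintro z (rfl | ⟨rfl | hz, -⟩)
        · exact Or.inr hdH
        · exact Or.inl rfl
        · exact Or.inr (hA hz.1)
      · simp [hay.symm]
      · rw [encard_swap haA₂ hdA₂, (hAs c hc y hyE hyH).encard_eq_eRank]
    refine ⟨_, _, hstart c hc hcl, hend d hd hdcl, hbases c hc hcl,
      .head (hfirst c hc hcl) (.head (b := ![insert d (insert y (A \ {c}) \ {a}),
        insert x (insert a (B \ {y}) \ {d}), insert c (C \ {x})]) ?_ (.single ?_))⟩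
    · refine .of_three_zero_one a d (hAs c hc y hyE hyH) hBx (hCs c (hA hc) hcl) hA₂ (hB'' d hd)
        haA₂ (by simp [hax, haB]) (by simp [hdB, hdy]) hdA₂ rfl ?_
      ext z; simp only [mem_insert_iff, mem_sdiff, mem_singleton_iff]; grind
    · refine .of_three_zero_two d c hA₂ (hB'' d hd) (hCs c (hA hc) hcl) (hAs a ha y hyE hyH)
        (hCs d hdH hdcl) (mem_insert _ _) ?_ (mem_insert _ _) ?_ ?_ ?_
      · simp [hcd.symm, hdC]
      · simp [hcd, hcy]
      · ext z; simp only [mem_insert_iff, mem_sdiff, mem_singleton_iff]; grind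
      · ext z; simp only [mem_insert_iff, mem_sdiff, mem_singleton_iff]; grind

/-! ### A subset of `H` next to a swap between two bases -/

/-- A swap of two elements outside `H`. -/
theorem joinedInBases_of_notMem_of_notMem [M.Finite] (hH : IsStressedHyperplane M H)
    {A B C : Set α} {b c : α} (hA : A ⊆ H) (hAc : A.encard = M.eRank) (hB : M.IsBase B)
    (hBH : (B \ H).Nontrivial) (hC : M.IsBase C) (hb : b ∈ B) (hbC : b ∉ C) (hc : c ∈ C)
    (hcB : c ∉ B) (hbH : b ∉ H) (hcH : c ∉ H) (hB' : M.IsBase (insert c (B \ {b})))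
    (hC' : M.IsBase (insert b (C \ {c}))) :
    JoinedInBases M H ![A, B, C] ![A, insert c (B \ {b}), insert b (C \ {c})] := by
  obtain ⟨y, ⟨hy, hyH⟩, hyb⟩ := hBH.exists_ne b
  obtain ⟨a, ha, -, hacl⟩ := hH.exists_notMem_closure_sdiff hA hAc hB hb hy hyH hyb.symm b
  obtain ⟨h1, h2, haB, hbA⟩ := hH.isBase_of_notMem_closure hA hAc hB hb hbH ha hacl
  have hcA : c ∉ A := fun h => hcH (hA h)
  have hac : a ≠ c := by rintro rfl; exact hcA ha
  have hbc : b ≠ c := by rintro rfl; exact hbC hc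
  have hAr : IsRelaxedBase M H A := Or.inr ⟨hA, hAc⟩
  have h3 : M.IsBase (insert c (A \ {a})) :=
    hH.isBase_insert (sdiff_subset.trans hA)
      (by rw [encard_sdiff_singleton_add_one ha, hAc]) (hC.subset_ground hc) hcH
  -- Both lowered tuples have the same second entry, and the swap of `b` and `c` now takes place
  -- against the first entry, which accepts either.
  refine ⟨![insert b (A \ {a}), insert a (B \ {b}), C],
    ![insert c (A \ {a}), insert a (B \ {b}), insert b (C \ {c})], ?_, ?_, ?_, .single ?_⟩
  · exact .of_three_zero_one a b hAr (.of_isBase hB) (.of_isBase hC) (.of_isBase h1)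
      (.of_isBase h2) ha haB hb hbA rfl rfl
  · refine .of_three_zero_one a c hAr (.of_isBase hB') (.of_isBase hC') (.of_isBase h3)
      (.of_isBase h2) ha (by simp [haB, hac]) (mem_insert _ _) hcA rfl ?_
    ext z; simp only [mem_insert_iff, mem_sdiff, mem_singleton_iff]; grind
  · simp [Fin.forall_fin_succ, h1, h2, hC]
  · refine .of_three_zero_two b c h1 h2 hC h3 hC' (mem_insert _ _) hbC hc
      (by simp [hcA, hbc.symm]) ?_ rfl
    ext z; simp only [mem_insert_iff, mem_sdiff, mem_singleton_iff]; grind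

/-- A swap of an element of `H` with an element outside `H`. -/
theorem joinedInBases_of_mem_of_notMem [M.Finite] (hH : IsStressedHyperplane M H)
    {A B C : Set α} {b c : α} (hA : A ⊆ H) (hAc : A.encard = M.eRank) (hB : M.IsBase B)
    (hC : M.IsBase C) (hb : b ∈ B) (hbC : b ∉ C) (hc : c ∈ C)
    (hcB : c ∉ B) (hbH : b ∈ H) (hcH : c ∉ H) (hB' : M.IsBase (insert c (B \ {b})))
    (hC' : M.IsBase (insert b (C \ {c}))) :
    JoinedInBases M H ![A, B, C] ![A, insert c (B \ {b}), insert b (C \ {c})] := by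
  have hcA : c ∉ A := fun h => hcH (hA h)
  have hbc : b ≠ c := by rintro rfl; exact hbC hc
  have hAr : IsRelaxedBase M H A := Or.inr ⟨hA, hAc⟩
  have hcE := hC.subset_ground hc
  have hAs : ∀ a ∈ A, M.IsBase (insert c (A \ {a})) := fun a ha =>
    hH.isBase_insert (sdiff_subset.trans hA)
      (by rw [encard_sdiff_singleton_add_one ha, hAc]) hcE hcH
  -- If `b ∈ A`, exchanging this copy of `b` with `c` leads from both tuples to the same one.
  by_cases hbA : b ∈ A
  · refine ⟨![insert c (A \ {b}), B, insert b (C \ {c})],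
      ![insert c (A \ {b}), B, insert b (C \ {c})], ?_, ?_, ?_, .refl⟩
    · exact .of_three_zero_two b c hAr (.of_isBase hB) (.of_isBase hC) (.of_isBase (hAs b hbA))
        (.of_isBase hC') hbA hbC hc hcA rfl rfl
    · refine .of_three_zero_one b c hAr (.of_isBase hB') (.of_isBase hC')
        (.of_isBase (hAs b hbA)) (.of_isBase hB) hbA (by simp [hbc]) (mem_insert _ _) hcA rfl ?_
      ext z; simp only [mem_insert_iff, mem_sdiff, mem_singleton_iff]; grind
    · simp [Fin.forall_fin_succ, hAs b hbA, hB, hC']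
  obtain ⟨y, hy, hyH⟩ := not_subset.1 (hH.not_isBase_subset hB)
  obtain ⟨p, hp, -, hpcl⟩ := hH.exists_notMem_closure_sdiff hA hAc hB hb hy hyH
    (by rintro rfl; exact hyH hbH) b
  -- The base `insert b (C \ {c})` leaves `H` although `b` does not, so `C` has an outer element
  -- besides `c`.
  obtain ⟨w, hw, hwH⟩ := not_subset.1 (hH.not_isBase_subset hC')
  have hwb : w ≠ b := by rintro rfl; exact hwH hbH
  obtain ⟨q, hq, -, hqcl⟩ := hH.exists_notMem_closure_sdiff hA hAc hC hc
    (hw.resolve_left hwb).1 hwH (fun h => (hw.resolve_left hwb).2 h.symm) b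
  obtain ⟨-, hC₁, hqC, -⟩ := hH.isBase_of_notMem_closure hA hAc hC hc hcH hq hqcl
  have hpE := hH.1.1.subset_ground (hA hp)
  have hB₁ := isBase_swap_of_notMem_closure hB hb hpE hpcl
  have hpb : p ≠ b := by rintro rfl; exact hbA hp
  have hqb : q ≠ b := by rintro rfl; exact hbA hq
  have hpc : p ≠ c := by rintro rfl; exact hcA hp
  have hqc : q ≠ c := by rintro rfl; exact hcA hq
  have hpB : p ∉ B := fun h =>
    hpcl (M.mem_closure_of_mem ⟨h, hpb⟩ (sdiff_subset.trans hB.subset_ground))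
  refine ⟨![insert c (A \ {q}), B, insert q (C \ {c})],
    ![insert c (A \ {p}), insert p (B \ {b}), insert b (C \ {c})], ?_, ?_, ?_, ?_⟩
  · exact .of_three_zero_two q c hAr (.of_isBase hB) (.of_isBase hC) (.of_isBase (hAs q hq))
      (.of_isBase hC₁) hq hqC hc hcA rfl rfl
  · refine .of_three_zero_one p c hAr (.of_isBase hB') (.of_isBase hC') (.of_isBase (hAs p hp))
      (.of_isBase hB₁) hp (by simp [hpc, hpB]) (mem_insert _ _) hcA rfl ?_
    ext z; simp only [mem_insert_iff, mem_sdiff, mem_singleton_iff]; grind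
  · simp [Fin.forall_fin_succ, hAs q hq, hB, hC₁]
  by_cases hpq : p = q
  · subst hpq
    refine .single (.of_three_one_two b p (hAs p hp) hB hC₁ hB₁ hC' hb ?_ (mem_insert _ _) hpB rfl
      ?_)
    · simp [hpb.symm, hbC]
    · ext z; simp only [mem_insert_iff, mem_sdiff, mem_singleton_iff]; grind
  have hpA₁ : p ∈ insert c (A \ {q}) := Or.inr ⟨hp, hpq⟩
  have hbA₁ : b ∉ insert c (A \ {q}) := by simp [hbA, hbc]
  have hA₂ : M.IsBase (insert b (insert c (A \ {q}) \ {p})) := by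
    refine hH.isBase_of_subset_insert (x := c) ?_ ?_ ?_ hcE hcH
    · rintro z (rfl | ⟨rfl | hz, -⟩)
      · exact Or.inr hbH
      · exact Or.inl rfl
      · exact Or.inr (hA hz.1)
    · simp [hpc.symm]
    · rw [encard_swap hpA₁ hbA₁, (hAs q hq).encard_eq_eRank]
  refine .head (b := ![insert b (insert c (A \ {q}) \ {p}), insert p (B \ {b}),
    insert q (C \ {c})]) ?_ (.single ?_)
  · exact .of_three_zero_one p b (hAs q hq) hB hC₁ hA₂ hB₁ hpA₁ hpB hb hbA₁ rfl rfl
  · refine .of_three_zero_two b q hA₂ hB₁ hC₁ (hAs p hp) hC' (mem_insert _ _) ?_ (mem_insert _ _)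
      ?_ ?_ ?_
    · simp [hqb.symm, hbC]
    · simp [hqb, hqc]
    · ext z; simp only [mem_insert_iff, mem_sdiff, mem_singleton_iff]; grind
    · ext z; simp only [mem_insert_iff, mem_sdiff, mem_singleton_iff]; grind

/-- If `e` lies in the closure of `insert f K`, but is independent over `K`, then `e` and `f` span
the same flat over `K`. -/
theorem closure_insert_eq_of_mem [M.Finite] {K : Set α} {e f : α} (he : M.Indep (insert e K))
    (heK : e ∉ K) (hfK : f ∉ K) (hf : f ∈ M.E) (h : e ∈ M.closure (insert f K)) :
    M.closure (insert e K) = M.closure (insert f K) := by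
  have hK : K ⊆ M.E := (subset_insert _ _).trans he.subset_ground
  have hsub : insert e K ⊆ M.closure (insert f K) := insert_subset h
    ((subset_insert _ _).trans (M.subset_closure _ (insert_subset hf hK)))
  rw [← M.closure_closure (insert f K)]
  refine (M.isRkFinite_set _).closure_eq_closure_of_subset_of_eRk_ge_eRk hsub ?_
  rw [M.eRk_closure_eq, he.eRk_eq_encard, encard_insert_of_notMem heK,
    ← encard_insert_of_notMem hfK]
  exact M.eRk_le_encard _

/-- A swap of two elements of `H`. -/
theorem joinedInBases_of_mem_of_mem [M.Finite] (hH : IsStressedHyperplane M H)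
    {A B C : Set α} {b c : α} (hA : A ⊆ H) (hAc : A.encard = M.eRank) (hB : M.IsBase B)
    (hBH : (B \ H).Nontrivial) (hC : M.IsBase C) (hb : b ∈ B) (hbC : b ∉ C) (hc : c ∈ C)
    (hcB : c ∉ B) (hbH : b ∈ H) (hcH : c ∈ H) (hB' : M.IsBase (insert c (B \ {b})))
    (hC' : M.IsBase (insert b (C \ {c}))) :
    JoinedInBases M H ![A, B, C] ![A, insert c (B \ {b}), insert b (C \ {c})] := by
  obtain ⟨x, ⟨hx, hxH⟩, y, ⟨hy, hyH⟩, hxy⟩ := hBH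
  have hbc : b ≠ c := by rintro rfl; exact hbC hc
  have hbx : b ≠ x := by rintro rfl; exact hxH hbH
  have hcx : c ≠ x := by rintro rfl; exact hxH hcH
  have hby : b ≠ y := by rintro rfl; exact hyH hbH
  have hxA : x ∉ A := fun h => hxH (hA h)
  have hxE := hB.subset_ground hx
  have hbE := hB.subset_ground hb
  have hcE := hC.subset_ground hc
  have hAr : IsRelaxedBase M H A := Or.inr ⟨hA, hAc⟩
  have hxB' : x ∈ insert c (B \ {b}) := Or.inr ⟨hx, hbx.symm⟩
  have hyB' : y ∈ insert c (B \ {b}) := Or.inr ⟨hy, hby.symm⟩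
  have hAs : ∀ a ∈ A, M.IsBase (insert x (A \ {a})) := fun a ha =>
    hH.isBase_insert (sdiff_subset.trans hA)
      (by rw [encard_sdiff_singleton_add_one ha, hAc]) hxE hxH
  have hKb : insert b ((B \ {x}) \ {b}) = B \ {x} := by simp [hb, hbx]
  have hKc : insert c ((B \ {x}) \ {b}) = insert c (B \ {b}) \ {x} := by
    ext z; simp only [mem_insert_iff, mem_sdiff, mem_singleton_iff]; grind
  have hcK : c ∉ (B \ {x}) \ {b} := fun h => hcB h.1.1
  have hbK : b ∉ (B \ {x}) \ {b} := fun h => h.2 rfl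
  have hiB : M.Indep (B \ {x}) := hB.indep.subset sdiff_subset
  have hiB' : M.Indep (insert c (B \ {b}) \ {x}) := hB'.indep.subset sdiff_subset
  have hbm : b ∈ M.closure (B \ {x}) := M.mem_closure_of_mem ⟨hb, hbx⟩ hiB.subset_ground
  have hcm : c ∈ M.closure (insert c (B \ {b}) \ {x}) :=
    M.mem_closure_of_mem ⟨mem_insert _ _, hcx⟩ hiB'.subset_ground
  have hstart : ∀ p ∈ A, p ∉ M.closure (B \ {x}) → Step (IsRelaxedBase M H) ![A, B, C]
      ![insert x (A \ {p}), insert p (B \ {x}), C] := fun p hp hpcl => by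
    obtain ⟨-, h2, h3, -⟩ := hH.isBase_of_notMem_closure hA hAc hB hx hxH hp hpcl
    exact .of_three_zero_one p x hAr (.of_isBase hB) (.of_isBase hC) (.of_isBase (hAs p hp))
      (.of_isBase h2) hp h3 hx hxA rfl rfl
  have hend : ∀ q ∈ A, q ∉ M.closure (insert c (B \ {b}) \ {x}) → Step (IsRelaxedBase M H)
      ![A, insert c (B \ {b}), insert b (C \ {c})]
      ![insert x (A \ {q}), insert q (insert c (B \ {b}) \ {x}), insert b (C \ {c})] :=
    fun q hq hqcl => by
    obtain ⟨-, h2, h3, -⟩ := hH.isBase_of_notMem_closure hA hAc hB' hxB' hxH hq hqcl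
    exact .of_three_zero_one q x hAr (.of_isBase hB') (.of_isBase hC') (.of_isBase (hAs q hq))
      (.of_isBase h2) hq h3 hxB' hxA rfl rfl
  -- If one `p` can replace `x` both in `B` and in the swapped base, the swap of `b` and `c`
  -- connects the two lowered tuples.
  by_cases hcommon : ∃ p ∈ A, p ∉ M.closure (B \ {x}) ∧ p ∉ M.closure (insert c (B \ {b}) \ {x})
  · obtain ⟨p, hp, hp1, hp2⟩ := hcommon
    have hpb : p ≠ b := by rintro rfl; exact hp1 hbm
    have hpc : p ≠ c := by rintro rfl; exact hp2 hcm
    obtain ⟨-, h2, -, -⟩ := hH.isBase_of_notMem_closure hA hAc hB hx hxH hp hp1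
    obtain ⟨-, h4, -, -⟩ := hH.isBase_of_notMem_closure hA hAc hB' hxB' hxH hp hp2
    refine ⟨_, _, hstart p hp hp1, hend p hp hp2, ?_, .single ?_⟩
    · simp [Fin.forall_fin_succ, hAs p hp, h2, hC]
    · refine .of_three_one_two b c (hAs p hp) h2 hC h4 hC' (Or.inr ⟨hb, hbx⟩) hbC hc
        (by simp [hpc.symm, hcB]) ?_ rfl
      ext z; simp only [mem_insert_iff, mem_sdiff, mem_singleton_iff]; grind
  push Not at hcommon
  -- hence `b` and `c` are not parallel over `B \ {x, b}`
  obtain ⟨p₀, hp₀, -, hp₀cl⟩ := hH.exists_notMem_closure_sdiff hA hAc hB hx hy hyH hxy x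
  obtain ⟨q₀, hq₀, -, hq₀cl⟩ := hH.exists_notMem_closure_sdiff hA hAc hB' hxB' hyB' hyH hxy x
  have hbcl : b ∉ M.closure (insert c (B \ {b}) \ {x}) := fun h => by
    rw [← hKc] at h
    have := closure_insert_eq_of_mem (hKb.symm ▸ hiB) hbK hcK hcE h
    rw [hKb, hKc] at this
    exact hp₀cl (this ▸ hcommon p₀ hp₀ hp₀cl)
  have hccl : c ∉ M.closure (B \ {x}) := fun h => by
    rw [← hKb] at h
    have := closure_insert_eq_of_mem (hKc.symm ▸ hiB') hcK hbK hbE h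
    rw [hKb, hKc] at this
    exact hp₀cl (this ▸ hcommon p₀ hp₀ hp₀cl)
  -- Taking `p = c` and `q = b` whenever these lie in `A` ensures that neither `b` nor `c` remains
  -- in the first entry once `p` and `q` are removed.
  obtain ⟨p, hp, hpcl, hpc⟩ : ∃ p ∈ A, p ∉ M.closure (B \ {x}) ∧ (c ∈ A → p = c) := by
    by_cases hcA : c ∈ A
    · exact ⟨c, hcA, hccl, fun _ => rfl⟩
    · exact ⟨p₀, hp₀, hp₀cl, fun h => absurd h hcA⟩
  obtain ⟨q, hq, hqcl, hqb⟩ : ∃ q ∈ A, q ∉ M.closure (insert c (B \ {b}) \ {x}) ∧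
      (b ∈ A → q = b) := by
    by_cases hbA : b ∈ A
    · exact ⟨b, hbA, hbcl, fun _ => rfl⟩
    · exact ⟨q₀, hq₀, hq₀cl, fun h => absurd h hbA⟩
  have hpE := hH.1.1.subset_ground (hA hp)
  have hqE := hH.1.1.subset_ground (hA hq)
  have hpb : p ≠ b := by rintro rfl; exact hpcl hbm
  have hqc : q ≠ c := by rintro rfl; exact hqcl hcm
  have hpcl' := hcommon p hp hpcl
  have hpq : p ≠ q := by rintro rfl; exact hqcl hpcl'
  have hpx : p ≠ x := by rintro rfl; exact hxA hp
  have hqx : q ≠ x := by rintro rfl; exact hxA hq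
  obtain ⟨-, hB₁, hpB, -⟩ := hH.isBase_of_notMem_closure hA hAc hB hx hxH hp hpcl
  obtain ⟨-, hB₂, hqB', -⟩ := hH.isBase_of_notMem_closure hA hAc hB' hxB' hxH hq hqcl
  have hbB₁ : b ∈ insert p (B \ {x}) := Or.inr ⟨hb, hbx⟩
  have hpK : p ∉ (B \ {x}) \ {b} := fun h => hpB h.1.1
  have hKp : insert p ((B \ {x}) \ {b}) = insert p (B \ {x}) \ {b} := by
    ext z; simp only [mem_insert_iff, mem_sdiff, mem_singleton_iff]; grind
  -- Over `B \ {x, b}`, the elements `p` and `c` span the same flat, because `p` is not admissible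
  -- for the swapped base; `q` is outside this flat.
  have hD : M.IsBase (insert q (insert p (B \ {x}) \ {b})) := by
    refine isBase_swap_of_notMem_closure hB₁ hbB₁ hqE ?_
    rw [← hKp, closure_insert_eq_of_mem (hKp ▸ hB₁.indep.subset sdiff_subset) hpK hcK hcE
      (hKc ▸ hpcl'), hKc]
    exact hqcl
  have hqA₁ : q ∈ insert x (A \ {p}) := Or.inr ⟨hq, hpq.symm⟩
  have hAd : ∀ d ∈ H, d ∉ insert x (A \ {p}) \ {q} →
      M.IsBase (insert d (insert x (A \ {p}) \ {q})) := fun d hd hdA => by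
    refine hH.isBase_of_subset_insert (x := x) ?_ ?_ ?_ hxE hxH
    · rintro z (rfl | ⟨rfl | hz, -⟩)
      · exact Or.inr hd
      · exact Or.inl rfl
      · exact Or.inr (hA hz.1)
    · simp [hqx.symm]
    · rw [encard_insert_of_notMem hdA, encard_sdiff_singleton_add_one hqA₁,
        (hAs p hp).encard_eq_eRank]
  have hbA₁ : b ∉ insert x (A \ {p}) \ {q} := by
    rintro ⟨rfl | h, h'⟩
    · exact hbx rfl
    · exact h' (hqb h.1).symm
  have hcA₁ : c ∉ insert x (A \ {p}) \ {q} := by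
    rintro ⟨rfl | h, h'⟩
    · exact hcx rfl
    · exact h.2 (hpc h.1).symm
  refine ⟨_, _, hstart p hp hpcl, hend q hq hqcl,
    by simp [Fin.forall_fin_succ, hAs p hp, hB₁, hC], ?_⟩
  -- The path swaps `q` with `b`, then `b` with `c`, then `c` with `p`, always using the first
  -- entry. The first swap is void if `q = b`, the last if `p = c`.
  have h1 : Relation.ReflTransGen (Step M.IsBase)
      ![insert x (A \ {p}), insert p (B \ {x}), C]
      ![insert b (insert x (A \ {p}) \ {q}), insert q (insert p (B \ {x}) \ {b}), C] := by
    by_cases hbA : b ∈ A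
    · obtain rfl := hqb hbA
      rw [insert_sdiff_singleton, insert_sdiff_singleton, insert_eq_of_mem hqA₁,
        insert_eq_of_mem hbB₁]
    · refine .single (.of_three_zero_one q b (hAs p hp) hB₁ hC (hAd b hbH hbA₁) hD hqA₁ ?_ hbB₁
        ?_ rfl rfl)
      · rintro (h | h)
        · exact hpq h.symm
        · exact hqB' (Or.inr ⟨h.1, fun h => hbA (h ▸ hq)⟩)
      · simp [hbA, hbx]
  have h2 : Step M.IsBase
      ![insert b (insert x (A \ {p}) \ {q}), insert q (insert p (B \ {x}) \ {b}), C]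
      ![insert c (insert x (A \ {p}) \ {q}), insert q (insert p (B \ {x}) \ {b}),
        insert b (C \ {c})] := by
    refine .of_three_zero_two b c (hAd b hbH hbA₁) hD hC (hAd c hcH hcA₁) hC' (mem_insert _ _)
      hbC hc ?_ ?_ rfl
    · rintro (h | h)
      · exact hbc h.symm
      · exact hcA₁ h
    · rw [insert_sdiff_self_of_notMem hbA₁]
  have h3 : Relation.ReflTransGen (Step M.IsBase)
      ![insert c (insert x (A \ {p}) \ {q}), insert q (insert p (B \ {x}) \ {b}),
        insert b (C \ {c})]
      ![insert x (A \ {q}), insert q (insert c (B \ {b}) \ {x}), insert b (C \ {c})] := by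
    by_cases hcA : c ∈ A
    · obtain rfl := hpc hcA
      have e1 : insert p (insert x (A \ {p}) \ {q}) = insert x (A \ {q}) := by
        ext z; simp only [mem_insert_iff, mem_sdiff, mem_singleton_iff]; grind
      rw [e1, ← hKp, hKc]
    · have hcp : c ≠ p := by rintro rfl; exact hcA hp
      refine .single (.of_three_zero_one c p (hAd c hcH hcA₁) hD hC' (hAs q hq) hB₂
        (mem_insert _ _) ?_ ?_ ?_ ?_ ?_)
      · simp [hqc.symm, hcp, hcB]
      · simp [hpb]
      · simp [hcp.symm, hpx]
      · ext z; simp only [mem_insert_iff, mem_sdiff, mem_singleton_iff]; grind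
      · ext z; simp only [mem_insert_iff, mem_sdiff, mem_singleton_iff]; grind
  exact (h1.tail h2).trans h3

/-- A swap between two bases of `M`, one of which has two elements outside `H`. -/
theorem joinedInBases_of_isBase [M.Finite] (hH : IsStressedHyperplane M H)
    {A B C : Set α} {b c : α} (hA : A ⊆ H) (hAc : A.encard = M.eRank) (hB : M.IsBase B)
    (hBH : (B \ H).Nontrivial) (hC : M.IsBase C) (hb : b ∈ B) (hbC : b ∉ C) (hc : c ∈ C)
    (hcB : c ∉ B) (hB' : M.IsBase (insert c (B \ {b})))
    (hC' : M.IsBase (insert b (C \ {c}))) :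
    JoinedInBases M H ![A, B, C] ![A, insert c (B \ {b}), insert b (C \ {c})] := by
  by_cases hbH : b ∈ H
  · by_cases hcH : c ∈ H
    · exact joinedInBases_of_mem_of_mem hH hA hAc hB hBH hC hb hbC hc hcB hbH hcH hB' hC'
    · exact joinedInBases_of_mem_of_notMem hH hA hAc hB hC hb hbC hc hcB hbH hcH hB' hC'
  · by_cases hcH : c ∈ H
    -- This is the mixed case read backwards, so it is applied to the swapped bases.
    · have hbc : b ≠ c := by rintro rfl; exact hbC hc
      have hB₁ : insert b (insert c (B \ {b}) \ {c}) = B := by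
        ext z; simp only [mem_insert_iff, mem_sdiff, mem_singleton_iff]; grind
      have hC₁ : insert c (insert b (C \ {c}) \ {b}) = C := by
        ext z; simp only [mem_insert_iff, mem_sdiff, mem_singleton_iff]; grind
      have h := joinedInBases_of_mem_of_notMem hH hA hAc hB' hC' (mem_insert _ _)
        (by simp [hbc.symm]) (mem_insert _ _) (by simp [hbc]) hcH hbH
        (by rwa [hB₁]) (by rwa [hC₁])
      rw [hB₁, hC₁] at h
      exact h.symm
    · exact joinedInBases_of_notMem_of_notMem hH hA hAc hB hBH hC hb hbC hc hcB hbH hcH hB' hC'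

/-! ### Exchanges below a given level -/

/-- An exchange between two tuples of level less than `l`. -/
def StepBelow (P : Set α → Prop) (H : Set α) (l : ℕ) (B C : Fin n → Set α) : Prop :=
  Step P B C ∧ level H B < l ∧ level H C < l

theorem level_extend_lt {f : Fin m → Fin n} (hf : Function.Injective f) {S : Fin m → Set α}
    (hS : ∀ i, ¬ S i ⊆ H) {T : Fin n → Set α} {i₀ : Fin m} (hi₀ : T (f i₀) ⊆ H) :
    level H (Function.extend f S T) < level H T := by
  refine level_lt hi₀ (by rw [hf.extend_apply]; exact hS i₀) fun q hq => ?_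
  by_cases hk : ∃ l, f l = q
  · obtain ⟨l, rfl⟩ := hk
    rw [hf.extend_apply] at hq
    exact absurd hq (hS l)
  · rwa [Function.extend_apply' _ _ _ hk] at hq

/-- No base of `M` lies in `H`, while `T` has an entry inside `H` among the selected positions;
hence the whole path stays below the level of `T`. -/
theorem reflTransGen_extend [M.Finite] (hH : IsStressedHyperplane M H) {f : Fin m → Fin n}
    (hf : Function.Injective f) {S S' : Fin m → Set α} {T : Fin n → Set α}
    (hT : ∀ i, IsRelaxedBase M H (T i)) {i₀ : Fin m} (hi₀ : T (f i₀) ⊆ H)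
    (h : Relation.ReflTransGen (Step M.IsBase) S S') :
    Relation.ReflTransGen (StepBelow (IsRelaxedBase M H) H (level H T))
      (Function.extend f S T) (Function.extend f S' T) := by
  induction h with
  | refl => exact .refl
  | tail _ h ih =>
    exact ih.tail ⟨(h.mono fun _ => .of_isBase).extend hf hT,
      level_extend_lt hf (fun i => hH.not_isBase_subset (h.1 i)) hi₀,
      level_extend_lt hf (fun i => hH.not_isBase_subset (h.2.1 i)) hi₀⟩

/-- Two exchanges commute if they are made at different positions, or share one position and the
elements involved there are different. -/
theorem Swaps.commute {T T₁ T' : Fin n → Set α} {p k i j : Fin n} {c x a b : α}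
    (h₁ : Swaps T T₁ p k c x) (h' : Swaps T T' i j a b) (hki : k ≠ i) (hkj : k ≠ j)
    (hpj : p ≠ j) (hpi : p = i → c ≠ a ∧ b ≠ x) :
    ∃ T₁', Swaps T' T₁' p k c x ∧ Swaps T₁ T₁' i j a b ∧ T₁' k = T₁ k ∧
      (p ≠ i → T₁' p = T₁ p) := by
  have hTk : T' k = T k := h'.rest k hki hkj
  have hTj : T₁ j = T j := h₁.rest j hpj.symm hkj.symm
  by_cases hp : p = i
  · subst hp
    obtain ⟨hca, hbx⟩ := hpi rfl
    have hs : Swaps T' (swapAt T' p k c x) p k c x := by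
      refine swaps_swapAt h₁.ne ?_ (hTk ▸ h₁.notMem_right) (hTk ▸ h₁.mem_right) ?_
      · rw [h'.left]; exact Or.inr ⟨h₁.mem_left, hca⟩
      · rw [h'.left]
        rintro (h | h)
        · exact hbx h.symm
        · exact h₁.notMem_left h.1
    have hk : swapAt T' p k c x k = T₁ k := by rw [hs.right, h₁.right, hTk]
    refine ⟨_, hs, ⟨hpj, ?_, hTj ▸ h'.notMem_right, hTj ▸ h'.mem_right, ?_, ?_, ?_, ?_⟩, hk,
      fun h => absurd rfl h⟩
    · rw [h₁.left]; exact Or.inr ⟨h'.mem_left, hca.symm⟩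
    · rw [h₁.left]
      rintro (h | h)
      · exact hbx h
      · exact h'.notMem_left h.1
    · have := h₁.mem_left
      have := h₁.notMem_left
      have := h'.mem_left
      have := h'.notMem_left
      rw [hs.left, h₁.left, h'.left]
      ext z; simp only [mem_insert_iff, mem_sdiff, mem_singleton_iff]; grind
    · rw [hs.rest j hpj.symm hkj.symm, h'.right, hTj]
    · intro l hlp hlj
      by_cases hlk : l = k
      · rw [hlk, hk]
      · rw [hs.rest l hlp hlk, h'.rest l hlp hlj, h₁.rest l hlp hlk]
  · have hTp : T' p = T p := h'.rest p hp hpj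
    have hTi : T₁ i = T i := h₁.rest i (Ne.symm hp) hki.symm
    have hs : Swaps T' (swapAt T' p k c x) p k c x :=
      swaps_swapAt h₁.ne (hTp ▸ h₁.mem_left) (hTk ▸ h₁.notMem_right) (hTk ▸ h₁.mem_right)
        (hTp ▸ h₁.notMem_left)
    have hk : swapAt T' p k c x k = T₁ k := by rw [hs.right, h₁.right, hTk]
    have hpp : swapAt T' p k c x p = T₁ p := by rw [hs.left, h₁.left, hTp]
    refine ⟨_, hs, ⟨h'.ne, hTi ▸ h'.mem_left, hTj ▸ h'.notMem_right, hTj ▸ h'.mem_right,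
      hTi ▸ h'.notMem_left, ?_, ?_, ?_⟩, hk, fun _ => hpp⟩
    · rw [hs.rest i (Ne.symm hp) hki.symm, h'.left, hTi]
    · rw [hs.rest j hpj.symm hkj.symm, h'.right, hTj]
    · intro l hli hlj
      by_cases hlk : l = k
      · rw [hlk, hk]
      by_cases hlp : l = p
      · rw [hlp, hpp]
      · rw [hs.rest l hlp hlk, h'.rest l hli hlj, h₁.rest l hlp hlk]

/-! ### Two exchanges that lower the level of the same tuple -/

theorem injective_vec_two {p k : Fin n} (h : p ≠ k) : Function.Injective ![p, k] := by
  intro u v huv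
  fin_cases u <;> fin_cases v <;> simp_all

theorem injective_vec_three {p k l : Fin n} (h₁ : p ≠ k) (h₂ : p ≠ l) (h₃ : k ≠ l) :
    Function.Injective ![p, k, l] := by
  intro u v huv
  fin_cases u <;> fin_cases v <;> simp_all

/-- Two level-lowering exchanges at the same position lead to tuples that are connected, by the
two-step condition. -/
theorem reflTransGen_of_swaps_same [M.Finite] (hH : IsStressedHyperplane M H)
    (hcond : TwoStepCondition M (relaxation M H hH)) {T T₁ T₂ : Fin n → Set α}
    (hT : ∀ i, IsRelaxedBase M H (T i)) (hT₁ : ∀ i, IsRelaxedBase M H (T₁ i))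
    (hT₂ : ∀ i, IsRelaxedBase M H (T₂ i)) {p k l : Fin n} {c x d y : α}
    (h₁ : Swaps T T₁ p k c x) (h₂ : Swaps T T₂ p l d y) (hp : T p ⊆ H) (hx : x ∉ H) (hy : y ∉ H)
    (hk : ¬ T₁ k ⊆ H) (hl : ¬ T₂ l ⊆ H) :
    Relation.ReflTransGen (StepBelow (IsRelaxedBase M H) H (level H T)) T₁ T₂ := by
  -- The degree is two or three according to whether the partners `k` and `l` coincide.
  have key : ∀ (m : ℕ) (f : Fin m → Fin n), m = 2 ∨ m = 3 → Function.Injective f →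
      ∀ u v w : Fin m, f u = p → f v = k → f w = l → (∀ s, f s = p ∨ f s = k ∨ f s = l) →
      Relation.ReflTransGen (StepBelow (IsRelaxedBase M H) H (level H T)) T₁ T₂ := by
    rintro m f hm hf u v w rfl rfl rfl hs
    have hb₁ : ∀ s, M.IsBase ((T₁ ∘ f) s) := by
      intro s
      refine (hT₁ _).isBase ?_
      by_cases hsu : f s = f u
      · rw [hsu, h₁.left]; exact fun h => hx (h (mem_insert _ _))
      by_cases hsv : f s = f v
      · rwa [hsv]
      rw [h₁.rest _ hsu hsv, ((hs s).resolve_left hsu).resolve_left hsv]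
      exact fun h => hy (h h₂.mem_right)
    have hb₂ : ∀ s, M.IsBase ((T₂ ∘ f) s) := by
      intro s
      refine (hT₂ _).isBase ?_
      by_cases hsu : f s = f u
      · rw [hsu, h₂.left]; exact fun h => hy (h (mem_insert _ _))
      by_cases hsw : f s = f w
      · rwa [hsw]
      rw [h₂.rest _ hsu hsw, ((hs s).resolve_left hsu).resolve_right hsw]
      exact fun h => hx (h h₁.mem_right)
    have e₁ : Function.extend f (T₁ ∘ f) T = T₁ := extend_comp_eq hf fun q hq =>
      h₁.rest q (fun h => hq ⟨u, h.symm⟩) (fun h => hq ⟨v, h.symm⟩)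
    have e₂ : Function.extend f (T₂ ∘ f) T = T₂ := extend_comp_eq hf fun q hq =>
      h₂.rest q (fun h => hq ⟨u, h.symm⟩) (fun h => hq ⟨w, h.symm⟩)
    have hs₁ : Step (IsRelaxedBase M H) (T ∘ f) (T₁ ∘ f) :=
      ⟨fun _ => hT _, fun _ => hT₁ _, _, _, _, _, h₁.comp hf⟩
    have hs₂ : Step (IsRelaxedBase M H) (T ∘ f) (T₂ ∘ f) :=
      ⟨fun _ => hT _, fun _ => hT₂ _, _, _, _, _, h₂.comp hf⟩
    -- The sequence through `T` has two steps in the relaxation, and its ends are bases of `M` at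
    -- the selected positions. This is the only use of (*).
    have h := (exchangeConnected_iff.1 (hcond m hm _ _ hb₁ hb₂
      (exchangeConnectedIn_two (N := relaxation M H hH) hs₁.symm hs₂))).2
    have := reflTransGen_extend hH hf hT hp h
    rwa [e₁, e₂] at this
  have hpk := h₁.ne
  have hpl := h₂.ne
  by_cases hkl : k = l
  · subst hkl
    exact key 2 ![p, k] (Or.inl rfl) (injective_vec_two hpk) 0 1 1 rfl rfl rfl
      (by simp [Fin.forall_fin_two])
  · exact key 3 ![p, k, l] (Or.inr rfl) (injective_vec_three hpk hpl hkl) 0 1 2 rfl rfl rfl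
      (by simp [Fin.forall_fin_succ])

/-- Two level-lowering exchanges at different positions can be completed to a square. -/
theorem reflTransGen_of_swaps_disjoint {T T₁ T₂ : Fin n → Set α}
    (hT₁ : ∀ i, P (T₁ i)) (hT₂ : ∀ i, P (T₂ i)) {p q k l : Fin n} {c x d y : α}
    (h₁ : Swaps T T₁ p k c x) (h₂ : Swaps T T₂ q l d y) (hp : T p ⊆ H) (hq : T q ⊆ H)
    (hx : x ∉ H) (hy : y ∉ H) (hk : ¬ T₁ k ⊆ H) (hl : ¬ T₂ l ⊆ H) (hpq : p ≠ q) (hkl : k ≠ l) :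
    Relation.ReflTransGen (StepBelow P H (level H T)) T₁ T₂ := by
  have hkq : k ≠ q := by rintro rfl; exact hx (hq h₁.mem_right)
  have hpl : p ≠ l := by rintro rfl; exact hy (hp h₂.mem_right)
  obtain ⟨T₃, h3, h4, h5, h6⟩ := h₁.commute h₂ hkq hkl hpl fun h => absurd h hpq
  have hs₂ : Step P T₂ T₃ := h3.step hT₂ (h6 hpq ▸ hT₁ p) (h5 ▸ hT₁ k)
  have hs₁ : Step P T₁ T₃ := ⟨hT₁, hs₂.2.1, _, _, _, _, h4⟩
  have hl₁ := h₁.level_lt hp hx hk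
  have hl₂ := h₂.level_lt hq hy hl
  have hl₃ : level H T₃ < level H T₂ := by
    refine h3.level_lt ?_ hx (h5 ▸ hk)
    rwa [h₂.rest p hpq hpl]
  exact .head ⟨hs₁, hl₁, hl₃.trans hl₂⟩ (.single ⟨hs₂.symm, hl₃.trans hl₂, hl₂⟩)

/-- Two subsets of `H` can be exchanged independently with a base having three elements outside
`H`. -/
theorem IsStressedHyperplane.exists_isBase_swap_swap [M.Finite] (hH : IsStressedHyperplane M H)
    {A A' B : Set α} {x y z : α} (hA : A ⊆ H) (hAc : A.encard = M.eRank) (hA' : A' ⊆ H)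
    (hAc' : A'.encard = M.eRank) (hB : M.IsBase B) (hx : x ∈ B) (hy : y ∈ B) (hz : z ∈ B)
    (hxH : x ∉ H) (hyH : y ∉ H) (hzH : z ∉ H) (hxy : x ≠ y) (hxz : x ≠ z) (hyz : y ≠ z) :
    ∃ a ∈ A, ∃ a' ∈ A', ∃ u ∈ B, ∃ v ∈ B, u ∉ H ∧ v ∉ H ∧ u ≠ v ∧ a ∉ B ∧ a' ∉ B ∧ a ≠ a' ∧
      M.IsBase (insert a (B \ {u})) ∧ M.IsBase (insert a' (B \ {v})) ∧
      M.IsBase (insert a' (insert a (B \ {u}) \ {v})) := by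
  obtain ⟨a, ha, -, hacl⟩ := hH.exists_notMem_closure_sdiff hA hAc hB hx hy hyH hxy x
  obtain ⟨-, hB₁, haB, -⟩ := hH.isBase_of_notMem_closure hA hAc hB hx hxH ha hacl
  have hy₁ : y ∈ insert a (B \ {x}) := Or.inr ⟨hy, hxy.symm⟩
  have hz₁ : z ∈ insert a (B \ {x}) := Or.inr ⟨hz, hxz.symm⟩
  -- The third outer element `z` is what keeps the set left by the second exchange outside `H`.
  obtain ⟨a', ha', -, hacl'⟩ :=
    hH.exists_notMem_closure_sdiff hA' hAc' hB₁ hy₁ hz₁ hzH hyz y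
  obtain ⟨-, hB₂, haB₁, -⟩ := hH.isBase_of_notMem_closure hA' hAc' hB₁ hy₁ hyH ha' hacl'
  have haE := hH.1.1.subset_ground (hA ha)
  have haE' := hH.1.1.subset_ground (hA' ha')
  have hax' : a' ≠ x := by rintro rfl; exact hxH (hA' ha')
  have hay : a ≠ y := by rintro rfl; exact hyH (hA ha)
  have hay' : a' ≠ y := by rintro rfl; exact hyH (hA' ha')
  have haB' : a' ∉ B := fun h => haB₁ (Or.inr ⟨h, hax'⟩)
  have haa : a ≠ a' := by rintro rfl; exact haB₁ (mem_insert _ _)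
  have hax : a ≠ x := by rintro rfl; exact haB hx
  -- If `a'` cannot replace `y` in `B` directly, then `a'` and `x` span the same flat over `B \ {x,
  -- y}`, and assigning `a` to `y` and `a'` to `x` works.
  by_cases hcl : a' ∈ M.closure (B \ {y})
  swap
  · exact ⟨a, ha, a', ha', x, hx, y, hy, hxH, hyH, hxy, haB, haB', haa, hB₁,
      isBase_swap_of_notMem_closure hB hy haE' hcl, hB₂⟩
  have hKx : insert x ((B \ {x}) \ {y}) = B \ {y} := by
    ext w; simp only [mem_insert_iff, mem_sdiff, mem_singleton_iff]; grind
  have hKy : insert y ((B \ {x}) \ {y}) = B \ {x} := by simp [hy, hxy.symm]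
  have hB₂' : insert a' (insert a (B \ {x}) \ {y}) =
      insert a (insert a' ((B \ {x}) \ {y})) := by
    ext w; simp only [mem_insert_iff, mem_sdiff, mem_singleton_iff]; grind
  have hind : M.Indep (insert a (insert a' ((B \ {x}) \ {y}))) := hB₂' ▸ hB₂.indep
  have hind' := hind.subset (subset_insert _ _)
  have hxK : x ∉ (B \ {x}) \ {y} := fun h => h.1.2 rfl
  have hyK : y ∉ (B \ {x}) \ {y} := fun h => h.2 rfl
  have haK' : a' ∉ (B \ {x}) \ {y} := fun h => haB' h.1.1
  have haK : a ∉ insert a' ((B \ {x}) \ {y}) := by simp [haa, haB]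
  have hcl₁ : M.closure (insert a' ((B \ {x}) \ {y})) = M.closure (B \ {y}) := by
    rw [closure_insert_eq_of_mem hind' haK' hxK (hB.subset_ground hx) (hKx.symm ▸ hcl), hKx]
  have ha₁ : a ∉ M.closure (B \ {y}) := by
    rw [← hcl₁]
    exact (hind'.notMem_closure_iff_of_notMem haK haE).2 hind
  have ha₂ : a' ∉ M.closure (B \ {x}) := by
    intro h
    have := closure_insert_eq_of_mem hind' haK' hyK (hB.subset_ground hy) (hKy.symm ▸ h)
    rw [hcl₁, hKy] at this
    refine hB.indep.notMem_closure_sdiff_of_mem hx ?_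
    rw [← this]
    exact M.mem_closure_of_mem ⟨hx, hxy⟩ (sdiff_subset.trans hB.subset_ground)
  refine ⟨a, ha, a', ha', y, hy, x, hx, hyH, hxH, hxy.symm, haB, haB', haa,
    isBase_swap_of_notMem_closure hB hy haE ha₁, isBase_swap_of_notMem_closure hB hx haE' ha₂, ?_⟩
  convert hB₂ using 1
  ext w; simp only [mem_insert_iff, mem_sdiff, mem_singleton_iff]; grind

/-- Two level-lowering exchanges from the same tuple lead to tuples that are connected below its
level. -/
theorem reflTransGen_of_level_lt [M.Finite] (hH : IsStressedHyperplane M H)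
    (hcond : TwoStepCondition M (relaxation M H hH)) {T T₁ T₂ : Fin n → Set α}
    (hrich : n ≤ outerCount H T)
    (hs₁ : Step (IsRelaxedBase M H) T T₁) (hs₂ : Step (IsRelaxedBase M H) T T₂)
    (hl₁ : level H T₁ < level H T) (hl₂ : level H T₂ < level H T) :
    Relation.ReflTransGen (StepBelow (IsRelaxedBase M H) H (level H T)) T₁ T₂ := by
  obtain ⟨p, k, c, x, h₁, hp, hx, hk⟩ := hs₁.exists_of_level_lt hl₁
  obtain ⟨q, l, d, y, h₂, hq, hy, hl⟩ := hs₂.exists_of_level_lt hl₂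
  have hT := hs₁.1
  by_cases hpq : p = q
  · subst hpq
    exact reflTransGen_of_swaps_same hH hcond hT hs₁.2.1 hs₂.2.1 h₁ h₂ hp hx hy hk hl
  by_cases hkl : k = l
  swap
  · exact reflTransGen_of_swaps_disjoint hs₁.2.1 hs₂.2.1 h₁ h₂ hp hq hx hy hk hl hpq hkl
  subst hkl
  have hfin : ∀ {X}, IsRelaxedBase M H X → X.Finite :=
    fun h => M.set_finite _ (h.subset_ground hH)
  have hkq : k ≠ q := h₂.ne.symm
  have hT₁q : T₁ q ⊆ H := by rwa [h₁.rest q (Ne.symm hpq) hkq.symm]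
  -- `T₁` has the same `outerCount` as `T` and still the entry at `q` inside `H`, so it has an entry
  -- with two outer elements.
  obtain ⟨k', hk'⟩ := exists_nontrivial_of_le_outerCount (B := T₁) (H := H) (by
    rwa [outerCount_eq_of_multiUnion_eq (fun i => hfin (hs₁.2.1 i)) (fun i => hfin (hT i))
      h₁.multiUnion_eq]) hT₁q
  have hk'p : k' ≠ p := by
    rintro rfl
    rw [h₁.left] at hk'
    obtain ⟨u, ⟨hu, huH⟩, hux⟩ := hk'.exists_ne x
    exact huH (hp (hu.resolve_left hux).1)
  -- If this is the common partner, it lost `x` and kept two outer elements, so it has three in `T`.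
  -- It then admits independent exchanges with `p` and `q`, which form a square between `T₁` and
  -- `T₂`.
  by_cases hk'k : k' = k
  · subst hk'k
    rw [h₁.right] at hk'
    have hcH := hp h₁.mem_left
    obtain ⟨u, ⟨hu, huH⟩, v, ⟨hv, hvH⟩, huv⟩ := hk'
    have hu' := hu.resolve_left (by rintro rfl; exact huH hcH)
    have hv' := hv.resolve_left (by rintro rfl; exact hvH hcH)
    have hkM := (hT k').isBase fun h => hx (h h₁.mem_right)
    obtain ⟨a, ha, a', ha', s, hs, t, ht, hsH, htH, hst, hak, hak', haa, hb₁, hb₂, hb₃⟩ :=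
      hH.exists_isBase_swap_swap hp (hT p).encard_eq hq (hT q).encard_eq hkM h₁.mem_right hu'.1
        hv'.1 hx huH hvH (Ne.symm hu'.2) (Ne.symm hv'.2) huv
    have hAs : ∀ {i : Fin n} {e : α}, T i ⊆ H → e ∈ T i → ∀ w ∈ T k', w ∉ H →
        M.IsBase (insert w (T i \ {e})) := fun {i} {e} hi he w hw hwH =>
      hH.isBase_insert (sdiff_subset.trans hi)
        (by rw [encard_sdiff_singleton_add_one he, (hT i).encard_eq]) (hkM.subset_ground hw) hwH
    have h₃ := swaps_swapAt h₁.ne ha hak hs fun h => hsH (hp h)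
    have h₄ := swaps_swapAt h₂.ne ha' hak' ht fun h => htH (hq h)
    have hs₃ : Step (IsRelaxedBase M H) T (swapAt T p k' a s) :=
      h₃.step hT (.of_isBase (h₃.left ▸ hAs hp ha s hs hsH)) (.of_isBase (h₃.right ▸ hb₁))
    have hs₄ : Step (IsRelaxedBase M H) T (swapAt T q k' a' t) :=
      h₄.step hT (.of_isBase (h₄.left ▸ hAs hq ha' t ht htH)) (.of_isBase (h₄.right ▸ hb₂))
    have h3k : ¬ swapAt T p k' a s k' ⊆ H := hH.not_isBase_subset (h₃.right ▸ hb₁)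
    have h4k : ¬ swapAt T q k' a' t k' ⊆ H := hH.not_isBase_subset (h₄.right ▸ hb₂)
    have hl₃ := h₃.level_lt hp hsH h3k
    have hl₄ := h₄.level_lt hq htH h4k
    have h3q : swapAt T p k' a s q = T q := h₃.rest q (Ne.symm hpq) h₂.ne
    have h4p : swapAt T q k' a' t p = T p := h₄.rest p hpq h₁.ne
    have h₅ := swaps_swapAt (B := swapAt T p k' a s) (a := a') (b := t) h₂.ne (h3q ▸ ha')
      (by rw [h₃.right]; simp [haa.symm, hak']) (by rw [h₃.right]; exact Or.inr ⟨ht, hst.symm⟩)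
      (by rw [h3q]; exact fun h => htH (hq h))
    have hs₅ := h₅.step hs₃.2.1
      (.of_isBase (by rw [h₅.left, h3q]; exact hAs hq ha' t ht htH))
      (.of_isBase (by rw [h₅.right, h₃.right]; exact hb₃))
    have h₆ : Swaps (swapAt T q k' a' t) (swapAt (swapAt T p k' a s) q k' a' t) p k' a s := by
      refine ⟨h₁.ne, h4p ▸ ha, by rw [h₄.right]; simp [haa, hak],
        by rw [h₄.right]; exact Or.inr ⟨hs, hst⟩, by rw [h4p]; exact fun h => hsH (hp h),
        ?_, ?_, ?_⟩
      · rw [h₅.rest p hpq h₁.ne, h₃.left, h4p]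
      · rw [h₅.right, h₃.right, h₄.right]
        ext w; simp only [mem_insert_iff, mem_sdiff, mem_singleton_iff]; grind
      · intro w hwp hwk
        by_cases hwq : w = q
        · rw [hwq, h₅.left, h₄.left, h3q]
        · rw [h₅.rest w hwq hwk, h₃.rest w hwp hwk, h₄.rest w hwq hwk]
    have hl₅ : level H (swapAt (swapAt T p k' a s) q k' a' t) < level H T := by
      refine (h₅.level_lt (h3q ▸ hq) htH ?_).trans hl₃
      rw [h₅.right, h₃.right]
      exact hH.not_isBase_subset hb₃
    refine (reflTransGen_of_swaps_same hH hcond hT hs₁.2.1 hs₃.2.1 h₁ h₃ hp hx hsH hk h3k).trans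
      (.head ⟨hs₅, hl₃, hl₅⟩ (.head ⟨⟨hs₅.2.1, hs₄.2.1, _, _, _, _, h₆.reverse⟩, hl₅, hl₄⟩ ?_))
    exact reflTransGen_of_swaps_same hH hcond hT hs₄.2.1 hs₂.2.1 h₄ h₂ hq htH hy h4k hl
  -- Otherwise lowering at `p` with partner `k'` gives an intermediate tuple: it shares `p` with
  -- `T₁` and uses positions disjoint from those of `T₂`.
  · rw [h₁.rest k' hk'p hk'k] at hk'
    obtain ⟨T₃, e, w, h₃, hw, -, hbk, hs₃, -⟩ := exists_step_level_lt hH hT hp hk'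
    have h3k := hH.not_isBase_subset hbk
    exact (reflTransGen_of_swaps_same hH hcond hT hs₁.2.1 hs₃.2.1 h₁ h₃ hp hx hw hk h3k).trans
      (reflTransGen_of_swaps_disjoint hs₃.2.1 hs₂.2.1 h₃ h₂ hp hq hw hy h3k hl hpq hk'k)

/-! ### Exchanges that keep the level -/

/-- The tuples `T` and `T'`, of the same level, can be lowered to tuples that are connected below
that level. -/
def JoinedBelow (M : Matroid α) (H : Set α) (T T' : Fin n → Set α) : Prop :=
  ∃ T₁ T₁', Step (IsRelaxedBase M H) T T₁ ∧ Step (IsRelaxedBase M H) T' T₁' ∧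
    level H T₁ < level H T ∧ level H T₁' < level H T ∧
    Relation.ReflTransGen (StepBelow (IsRelaxedBase M H) H (level H T)) T₁ T₁'

theorem JoinedInBases.joinedBelow [M.Finite] (hH : IsStressedHyperplane M H) {f : Fin m → Fin n}
    (hf : Function.Injective f) {T T' : Fin n → Set α} (hT : ∀ i, IsRelaxedBase M H (T i))
    (hT' : ∀ k ∉ range f, T' k = T k) {S S' : Fin m → Set α} (hS : T ∘ f = S)
    (hS' : T' ∘ f = S') {i₀ : Fin m} (hi₀ : T (f i₀) ⊆ H) (h : JoinedInBases M H S S') :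
    JoinedBelow M H T T' := by
  subst hS hS'
  obtain ⟨S₁, S₁', h1, h2, h3, h4⟩ := h
  refine ⟨_, Function.extend f S₁' T, h1.extend_of_comp hf hT, ?_,
    level_extend_lt hf (fun i => hH.not_isBase_subset (h3 i)) hi₀,
    level_extend_lt hf
      (fun i => hH.not_isBase_subset (forall_of_reflTransGen_step h4 h3 i)) hi₀,
    reflTransGen_extend hH hf hT hi₀ h4⟩
  have := h2.extend hf hT
  rwa [extend_comp_eq hf hT'] at this

/-- A swap away from a base having two elements outside `H`. -/
theorem joinedBelow_of_nontrivial [M.Finite] (hH : IsStressedHyperplane M H)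
    {T T' : Fin n → Set α} (hs : Step (IsRelaxedBase M H) T T') (hl : level H T' = level H T)
    {p k i j : Fin n} {a b : α} (h : Swaps T T' i j a b) (hp : T p ⊆ H) (hp' : T' p ⊆ H)
    (hpj : p ≠ j) (hki : k ≠ i) (hkj : k ≠ j) (hk : (T k \ H).Nontrivial) :
    JoinedBelow M H T T' := by
  have hkH := not_subset_of_nontrivial_sdiff hk
  have hT := hs.1
  have hkM := (hT k).isBase hkH
  have hpk : p ≠ k := by rintro rfl; exact hkH hp
  obtain ⟨x, ⟨hx, hxH⟩, y, ⟨hy, hyH⟩, hxy⟩ := hk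
  -- Avoiding `a` lets the lowering exchange commute with the given one even if `p = i`.
  obtain ⟨c, hc, hca, hcl⟩ :=
    hH.exists_notMem_closure_sdiff hp (hT p).encard_eq hkM hx hy hyH hxy a
  obtain ⟨h1, h2, h3, h4⟩ :=
    hH.isBase_of_notMem_closure hp (hT p).encard_eq hkM hx hxH hc hcl
  have h₁ := swaps_swapAt hpk hc h3 hx h4
  have hk₁ : M.IsBase (swapAt T p k c x k) := by rwa [h₁.right]
  have hs₁ : Step (IsRelaxedBase M H) T (swapAt T p k c x) :=
    h₁.step hT (.of_isBase (by rwa [h₁.left])) (.of_isBase hk₁)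
  obtain ⟨T₁', h5, h6, h7, -⟩ := h₁.commute h hki hkj hpj fun hpi => ⟨hca, by
    rintro rfl
    refine hxH (hp' ?_)
    rw [hpi, h.left]
    exact mem_insert _ _⟩
  have hs₁' : Step (IsRelaxedBase M H) T' T₁' := by
    refine h5.step hs.2.1 (.of_isBase ?_) (.of_isBase (h7 ▸ hk₁))
    rw [h5.left]
    exact hH.isBase_insert (sdiff_subset.trans hp')
      (by rw [encard_sdiff_singleton_add_one h5.mem_left, (hs.2.1 p).encard_eq])
      (hkM.subset_ground hx) hxH
  have hl₁ := h₁.level_lt hp hxH (hH.not_isBase_subset hk₁)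
  have hl₁' := hl ▸ h5.level_lt hp' hxH (hH.not_isBase_subset (h7 ▸ hk₁))
  exact ⟨_, T₁', hs₁, hs₁', hl₁, hl₁', .single ⟨⟨hs₁.2.1, hs₁'.2.1, _, _, _, _, h6⟩, hl₁, hl₁'⟩⟩

theorem joinedBelow_of_subset [M.Finite] (hH : IsStressedHyperplane M H)
    {T T' : Fin n → Set α} (hrich : n ≤ outerCount H T)
    (hs : Step (IsRelaxedBase M H) T T') (hl : level H T' = level H T)
    {i j : Fin n} {a b : α} (h : Swaps T T' i j a b) (hi : T i ⊆ H) : JoinedBelow M H T T' := by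
  have hT := hs.1
  have hij := h.ne
  obtain ⟨k, hk⟩ := exists_nontrivial_of_le_outerCount hrich hi
  have hki : k ≠ i := by rintro rfl; exact not_subset_of_nontrivial_sdiff hk hi
  have haH := hi h.mem_left
  by_cases hbH : b ∈ H
  · have hi' : T' i ⊆ H := by
      rw [h.left]; exact insert_subset hbH (sdiff_subset.trans hi)
    by_cases hkj : k = j
    · subst hkj
      have hk' : M.IsBase (T' k) := by
        refine (hs.2.1 k).isBase fun h' => ?_
        obtain ⟨x, hx, hxH⟩ := hk.nonempty
        refine hxH (h' ?_)
        rw [h.right]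
        exact Or.inr ⟨hx, by rintro rfl; exact hxH hbH⟩
      have hj := joinedInBases_two hH hi (hT i).encard_eq
        ((hT k).isBase (not_subset_of_nontrivial_sdiff hk)) hk h.mem_left h.notMem_right
        h.mem_right h.notMem_left hbH (h.right ▸ hk')
      refine hj.joinedBelow hH (injective_vec_two hij) hT ?_ ?_ ?_ (i₀ := 0) hi
      · intro l hl
        exact h.rest l (fun e => hl ⟨0, e.symm⟩) (fun e => hl ⟨1, e.symm⟩)
      · ext l; fin_cases l <;> rfl
      · rw [← h.left, ← h.right]; ext l; fin_cases l <;> rfl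
    · exact joinedBelow_of_nontrivial hH hs hl h hi hi' hij hki hkj hk
  -- Here `i` leaves `H`, so equality of levels forces `j` to enter it; thus `b` is the only outer
  -- element of `T j`.
  · have hj' : T' j ⊆ H := by
      by_contra hj'
      exact (h.level_lt hi hbH hj').ne hl
    have hjb : T j \ H = {b} := by
      refine Subsingleton.eq_singleton_of_mem ?_ ⟨h.mem_right, hbH⟩
      rintro u ⟨hu, huH⟩ v ⟨hv, hvH⟩
      rw [h.right] at hj'
      have key : ∀ w ∈ T j, w ∉ H → w = b := fun w hw hwH => by
        by_contra hwb
        exact hwH (hj' (Or.inr ⟨hw, hwb⟩))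
      rw [key u hu huH, key v hv hvH]
    have hkj : k ≠ j := by
      rintro rfl
      rw [hjb] at hk
      exact not_nontrivial_singleton hk
    have hj := joinedInBases_of_sdiff_eq_singleton hH hi (hT i).encard_eq
      ((hT j).isBase fun h' => hbH (h' h.mem_right)) hjb
      ((hT k).isBase (not_subset_of_nontrivial_sdiff hk)) hk h.mem_left h.notMem_right
    refine hj.joinedBelow hH (injective_vec_three hij hki.symm hkj.symm) hT ?_ ?_ ?_ (i₀ := 0) hi
    · intro l hl
      exact h.rest l (fun e => hl ⟨0, e.symm⟩) (fun e => hl ⟨1, e.symm⟩)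
    · ext l; fin_cases l <;> rfl
    · rw [← h.left, ← h.right, ← h.rest k hki hkj]; ext l; fin_cases l <;> rfl

theorem joinedBelow_of_isBase [M.Finite] (hH : IsStressedHyperplane M H)
    {T T' : Fin n → Set α} (hs : Step (IsRelaxedBase M H) T T')
    {p i j : Fin n} {a b : α} (h : Swaps T T' i j a b) (hp : T p ⊆ H) (hpi : p ≠ i) (hpj : p ≠ j)
    (hi : (T i \ H).Nontrivial) (hj : ¬ T j ⊆ H) (hi' : ¬ T' i ⊆ H) (hj' : ¬ T' j ⊆ H) :
    JoinedBelow M H T T' := by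
  have hT := hs.1
  have hj := joinedInBases_of_isBase hH hp (hT p).encard_eq
    ((hT i).isBase (not_subset_of_nontrivial_sdiff hi)) hi ((hT j).isBase hj) h.mem_left
    h.notMem_right h.mem_right h.notMem_left (h.left ▸ (hs.2.1 i).isBase hi')
    (h.right ▸ (hs.2.1 j).isBase hj')
  refine hj.joinedBelow hH (injective_vec_three hpi hpj h.ne) hT ?_ ?_ ?_ (i₀ := 0) hp
  · intro l hl
    exact h.rest l (fun e => hl ⟨1, e.symm⟩) (fun e => hl ⟨2, e.symm⟩)
  · ext l; fin_cases l <;> rfl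
  · rw [← h.left, ← h.right, ← h.rest p hpi hpj]; ext l; fin_cases l <;> rfl

/-- The cases depend on whether the exchange involves an entry inside `H`, and on whether it
involves an entry with two outer elements. -/
theorem joinedBelow_of_level_eq [M.Finite] (hH : IsStressedHyperplane M H)
    {T T' : Fin n → Set α} (hrich : n ≤ outerCount H T)
    (hs : Step (IsRelaxedBase M H) T T') (hl : level H T' = level H T) {p : Fin n}
    (hp : T p ⊆ H) : JoinedBelow M H T T' := by
  obtain ⟨hT, -, i, j, a, b, h⟩ := id hs
  by_cases hi : T i ⊆ H
  · exact joinedBelow_of_subset hH hrich hs hl h hi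
  by_cases hj : T j ⊆ H
  · exact joinedBelow_of_subset hH hrich hs hl h.symm hj
  -- An exchange between two entries not inside `H` cannot move one into `H`, for its reverse would
  -- lower the level.
  have key : ∀ {i j a b}, Swaps T T' i j a b → ¬ T i ⊆ H → ¬ T j ⊆ H → ¬ T' i ⊆ H := by
    intro i j a b h hi hj hi'
    refine (h.reverse.level_lt hi' (fun haH => hi ?_) hj).ne hl.symm
    rw [h.reverse.left]
    exact insert_subset haH (sdiff_subset.trans hi')
  have hi' := key h hi hj
  have hj' := key h.symm hj hi
  have hpi : p ≠ i := by rintro rfl; exact hi hp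
  have hpj : p ≠ j := by rintro rfl; exact hj hp
  obtain ⟨k, hk⟩ := exists_nontrivial_of_le_outerCount hrich hp
  by_cases hki : k = i
  · exact joinedBelow_of_isBase hH hs h hp hpi hpj (hki ▸ hk) hj hi' hj'
  by_cases hkj : k = j
  · exact joinedBelow_of_isBase hH hs h.symm hp hpj hpi (hkj ▸ hk) hi hj' hi'
  exact joinedBelow_of_nontrivial hH hs hl h hp (by rwa [h.rest p hpi hpj]) hpj hki hkj hk

/-! ### Eliminating the tuples of positive level -/

/-- `U` is `T`, if `T` has level less than `l`, or else is obtained from the tuple `T` of level `l`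
by a level-lowering exchange. -/
def LowersTo (M : Matroid α) (H : Set α) (l : ℕ) (T U : Fin n → Set α) : Prop :=
  (level H T < l ∧ U = T) ∨
    (level H T = l ∧ Step (IsRelaxedBase M H) T U ∧ level H U < level H T)

theorem exists_subset_of_level_pos {T : Fin n → Set α} (h : 0 < level H T) : ∃ p, T p ⊆ H := by
  by_contra! hcon
  rw [level] at h
  simp [hcon] at h

theorem Step.outerCount_eq [M.Finite] (hH : IsStressedHyperplane M H) {T T' : Fin n → Set α}
    (h : Step (IsRelaxedBase M H) T T') : outerCount H T' = outerCount H T := by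
  have hfin : ∀ {X}, IsRelaxedBase M H X → X.Finite :=
    fun h => M.set_finite _ (h.subset_ground hH)
  obtain ⟨h1, h2, i, j, a, b, h⟩ := h
  exact outerCount_eq_of_multiUnion_eq (fun i => hfin (h2 i)) (fun i => hfin (h1 i))
    h.multiUnion_eq

theorem exists_lowersTo [M.Finite] (hH : IsStressedHyperplane M H) {T : Fin n → Set α} {l : ℕ}
    (hl : 0 < l) (hT : ∀ i, IsRelaxedBase M H (T i)) (hrich : n ≤ outerCount H T)
    (hTl : level H T < l + 1) : ∃ U, LowersTo M H l T U := by
  rcases (Nat.lt_succ_iff.1 hTl).lt_or_eq with h | h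
  · exact ⟨T, Or.inl ⟨h, rfl⟩⟩
  · obtain ⟨p, hp⟩ := exists_subset_of_level_pos (h ▸ hl)
    obtain ⟨k, hk⟩ := exists_nontrivial_of_le_outerCount hrich hp
    obtain ⟨U, -, -, -, -, -, -, h1, h2⟩ := exists_step_level_lt hH hT hp hk
    exact ⟨U, Or.inr ⟨h, h1, h2⟩⟩

/-- If just one end has level `l`, the step itself lowers that end and is compared with the chosen
lowering. If both do, `joinedBelow_of_level_eq` supplies suitable lowerings, to which the chosen
ones are connected. -/
theorem reflTransGen_of_step_of_lowersTo [M.Finite] (hH : IsStressedHyperplane M H)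
    (hcond : TwoStepCondition M (relaxation M H hH)) {T T' U U' : Fin n → Set α} {l : ℕ}
    (hl : 0 < l) (hrich : n ≤ outerCount H T) (h : Step (IsRelaxedBase M H) T T')
    (hU : LowersTo M H l T U) (hU' : LowersTo M H l T' U') :
    Relation.ReflTransGen (StepBelow (IsRelaxedBase M H) H l) U U' := by
  have hrich' : n ≤ outerCount H T' := (h.outerCount_eq hH).symm ▸ hrich
  rcases hU with ⟨hT, rfl⟩ | ⟨hT, hs, hlt⟩
  · rcases hU' with ⟨hT', rfl⟩ | ⟨rfl, hs', hlt'⟩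
    · exact .single ⟨h, hT, hT'⟩
    · exact reflTransGen_of_level_lt hH hcond hrich' h.symm hs' hT hlt'
  · rcases hU' with ⟨hT', rfl⟩ | ⟨hT', hs', hlt'⟩
    · subst hT
      exact reflTransGen_of_level_lt hH hcond hrich hs h hlt hT'
    · obtain ⟨p, hp⟩ := exists_subset_of_level_pos (hT ▸ hl)
      obtain ⟨T₁, T₁', h1, h2, h3, h4, h5⟩ :=
        joinedBelow_of_level_eq hH hrich h (hT'.trans hT.symm) hp
      have h6 := reflTransGen_of_level_lt hH hcond hrich hs h1 hlt h3
      have h7 := reflTransGen_of_level_lt hH hcond hrich' h2 hs' (by rwa [hT', ← hT]) hlt'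
      rw [hT] at h5 h6
      rw [hT'] at h7
      exact (h6.trans h5).trans h7

theorem reflTransGen_of_lowersTo [M.Finite] (hH : IsStressedHyperplane M H)
    (hcond : TwoStepCondition M (relaxation M H hH)) {B C : Fin n → Set α} {l : ℕ} (hl : 0 < l)
    (hrich : n ≤ outerCount H B)
    (h : Relation.ReflTransGen (StepBelow (IsRelaxedBase M H) H (l + 1)) B C)
    {U U' : Fin n → Set α} (hU : LowersTo M H l B U) (hU' : LowersTo M H l C U') :
    Relation.ReflTransGen (StepBelow (IsRelaxedBase M H) H l) U U' := by
  induction h using Relation.ReflTransGen.head_induction_on generalizing U with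
  | refl =>
    -- Even a chain without steps may carry two different lowerings of its tuple.
    rcases hU with ⟨hT, rfl⟩ | ⟨rfl, hs, hlt⟩
    · rcases hU' with ⟨-, rfl⟩ | ⟨hT', -, -⟩
      · exact .refl
      · exact absurd hT' hT.ne
    · rcases hU' with ⟨hT', -⟩ | ⟨-, hs', hlt'⟩
      · exact absurd hT' (lt_irrefl _)
      · exact reflTransGen_of_level_lt hH hcond hrich hs hs' hlt hlt'
  | head h _ ih =>
    have hrich' := (h.1.outerCount_eq hH).symm ▸ hrich
    obtain ⟨V, hV⟩ := exists_lowersTo hH hl h.1.2.1 hrich' h.2.2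
    exact (reflTransGen_of_step_of_lowersTo hH hcond hl hrich h.1 hU hV).trans (ih hrich' hV)

theorem whiteHolds_of_relaxation [M.Finite] (hH : IsStressedHyperplane M H)
    (hN : WhiteHolds (relaxation M H hH)) (hcond : TwoStepCondition M (relaxation M H hH)) :
    WhiteHolds M := by
  intro n B C hB hC hBC
  rw [exchangeConnected_iff]
  refine ⟨hB, ?_⟩
  have hpath : Relation.ReflTransGen (Step (IsRelaxedBase M H)) B C :=
    (exchangeConnected_iff.1 (hN n B C (fun i => .of_isBase (hB i)) (fun i => .of_isBase (hC i))
      hBC)).2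
  have hrich : n ≤ outerCount H B :=
    le_outerCount (fun i => M.set_finite _ (hB i).subset_ground)
      fun i => hH.not_isBase_subset (hB i)
  have hlevel : ∀ D : Fin n → Set α, (∀ i, M.IsBase (D i)) → level H D = 0 := fun D hD => by
    simp [level, fun i => hH.not_isBase_subset (hD i)]
  -- A tuple has only `n` positions, so any path in the relaxation can serve as the start of the
  -- descent.
  have hbound : ∀ D : Fin n → Set α, level H D < n + 1 := fun D =>
    Nat.lt_succ_of_le ((ncard_le_card _).trans (by simp))
  have key : ∀ l, Relation.ReflTransGen (StepBelow (IsRelaxedBase M H) H (l + 1)) B C →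
      Relation.ReflTransGen (StepBelow (IsRelaxedBase M H) H 1) B C := by
    intro l
    induction l with
    | zero => exact id
    | succ l ih =>
      -- The end tuples have level zero, so they are their own replacements and stay fixed during
      -- the descent.
      exact fun h => ih (reflTransGen_of_lowersTo hH hcond l.succ_pos hrich h
        (Or.inl ⟨by rw [hlevel B hB]; exact l.succ_pos, rfl⟩)
        (Or.inl ⟨by rw [hlevel C hC]; exact l.succ_pos, rfl⟩))
  have hbase : ∀ D : Fin n → Set α, (∀ i, IsRelaxedBase M H (D i)) → level H D < 1 →
      ∀ i, M.IsBase (D i) := by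
    intro D hD hl i
    refine (hD i).isBase fun hi => ?_
    rw [Nat.lt_one_iff, level, ncard_eq_zero] at hl
    exact (hl ▸ hi : i ∈ (∅ : Set (Fin n)))
  exact Relation.ReflTransGen.mono (fun D E h => ⟨hbase D h.1.1 h.2.1, hbase E h.1.2.1 h.2.2,
    h.1.2.2⟩) _ _ (key n (Relation.ReflTransGen.mono (fun D E h => ⟨h, hbound D, hbound E⟩) _ _
      hpath))

end WhiteExchange

theorem theorem1p5 {α : Type*} (M : Matroid α) [M.Finite] (H : Set α)
    (hH : WhiteExchange.IsStressedHyperplane M H) :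
    (WhiteExchange.WhiteHolds M →
      WhiteExchange.WhiteHolds (WhiteExchange.relaxation M H hH)) ∧
    (WhiteExchange.WhiteHolds (WhiteExchange.relaxation M H hH) →
      WhiteExchange.TwoStepCondition M (WhiteExchange.relaxation M H hH) →
      WhiteExchange.WhiteHolds M) :=
  ⟨WhiteExchange.whiteHolds_relaxation hH, WhiteExchange.whiteHolds_of_relaxation hH⟩
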